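/- **Setting.** Consider the plant $\dot x_p=f_p(x_p,\hat u,w)$ and the controller $\dot x_c=f_c(x_c,\hat x_p)$, $u=g_c(x_c,x_p)$, with $x_p\in\mathbb R^{n_{x_p}}$, $x_c\in\mathbb R^{n_{x_c}}$, disturbance $w(t)\in\mathbb R^{n_w}$, and with $\hat u,\hat x_p$ held constant between sampling instants. Let $x=(x_p,x_c)$, $\hat x$ the value of $x$ at the last sampling instant, $e=\hat x-x$, $n_x=n_{x_p}+n_{x_c}$, and $$f(x,e,w)=\begin{pmatrix} f_p\big(x_p,\,g_c(x_c+e_{x_c},x_p+e_{x_p}),\,w\big)\\ f_c(x_c,\,x_p+e_{x_p})\end{pmatrix},\qquad g=-f,$$ where $f$ is continuous. For functions $\Gamma(x,\eta)\in\mathbb R$ and $S(\eta,x)\in\mathbb R$, $\mathcal H_{STC}$ is the hybrid system with state $\xi=(x,e,\eta,\tau,\tau_{\max})\in\mathbb R^{n_x}\times\mathbb R^{n_x}\times\mathbb R\times\mathbb R\times\mathbb R$, $$\dot\xi=(f(x,e,w),\,g(x,e,w),\,0,\,1,\,0)\ \text{ if }\tau\le\tau_{\max},\qquad \xi^+=(x,\,0,\,S(\eta,x),\,0,\,\Gamma(x,\eta))\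 \text{ if }\tau=\tau_{\max},$$ with solutions $\xi(t,j)$ on hybrid time domains (absolutely continuous in $t$) for locally integrable $w:\mathbb R_{\ge0}\to\mathbb R^{n_w}$, and with $\tau_{\max}(0,0)=\tau(0,0)\ge0$. Its sampling instants $t_0,t_1,\dots$ are the jump times: $t_j$ is the time of the jump from $\xi(t_j,j)$ to $\xi(t_j,j+1)$. A $\mathcal K_\infty$ function is a continuous, strictly increasing, unbounded $\alpha:\mathbb R_{\ge0}\to\mathbb R_{\ge0}$ with $\alpha(0)=0$ (class $\mathcal K$ if unboundedness is dropped). A continuous $\beta:\mathbb R_{\ge0}^2\to\mathbb R_{\ge0}$ is of class $\mathcal{KL}$ if it is of class $\mathcal K$ in the first argument and nonincreasing with limit $0$ at infinity in the second; $\beta:\mathbb R_{\ge0}^3\to\mathbb R_{\ge0}$ is of class $\mathcal{KLL}$ if $\beta(\cdot,r,\cdot)$ and $\beta(\cdot,\cdot,r)$ are of class $\mathcal{KL}$ for every $r\ge0$. $|\cdot|$ is the Euclidean norm. *Condition $(\epsilon,\gamma,L)$ holds for $V$ and $\alpha_w$* if $L,\gamma>0$, $\epsilon\in\mathbb R$,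 $\alpha_w\in\mathcal K_\infty$, $V:\mathbb R^{n_x}\to\mathbb R_{\ge0}$ is locally Lipschitz, and there are a locally Lipschitz $W:\mathbb R^{n_x}\to\mathbb R_{\ge0}$, a continuous $H:\mathbb R^{n_x}\times\mathbb R^{n_x}\times\mathbb R^{n_w}\to\mathbb R_{\ge0}$ and $\underline\alpha_W,\overline\alpha_W,\underline\alpha_V,\overline\alpha_V\in\mathcal K_\infty$ with $\underline\alpha_W(|e|)\le W(e)\le\overline\alpha_W(|e|)$ for all $e$, $\underline\alpha_V(|x|)\le V(x)\le\overline\alpha_V(|x|)$ for all $x$, $$\langle\nabla W(e),g(x,e,w)\rangle\le L\,W(e)+H(x,e,w)\quad\text{for all }x,w\text{ and almost all }e,$$ $$\langle\nabla V(x),f(x,e,w)\rangle\le-\epsilon V(x)-H^2(x,e,w)+\gamma^2W^2(e)+\alpha_w(|w|)\quad\text{for all }e,w\text{ and almost all }x.$$ For $\gamma,\Lambda>0$ let $r=\sqrt{|(\gamma/\Lambda)^2-1|}$ and let $T_{\max}(\gamma,\Lambda)$ be $\frac{\arctan r}{\Lambda r}$ if $\gamma>\Lambda$, $\frac1\Lambda$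 if $\gamma=\Lambda$, and $\frac{\operatorname{arctanh} r}{\Lambda r}$ if $\gamma<\Lambda$. **Mechanism.** Let $n_{\mathrm{par}}\ge1$, parameters $(\epsilon_i,\gamma_i,L_i)$, $i=1,\dots,n_{\mathrm{par}}$, $\delta\in(0,1)$, $\epsilon_{\mathrm{ref}}>0$ and $t_{\min}:=\delta T_{\max}(\gamma_1,L_1+\frac{\epsilon_1}2)$. Given $C(x,\eta)$, the value $\Gamma(x,\eta)$ is computed as follows: start with $\bar h=t_{\min}$; for $i=2,\dots,n_{\mathrm{par}}$ put $\Lambda_i=\max\{L_i+\frac{\epsilon_i}2,1-\delta\}$ and $$\bar h_i=\begin{cases}\min\Big\{\delta T_{\max}(\gamma_i,\Lambda_i),\ \frac{\log C(x,\eta)-\log V(x)}{-\epsilon_i+\epsilon_{\mathrm{ref}}}\Big\}& C(x,\eta)\ge V(x),\ -\epsilon_i+\epsilon_{\mathrm{ref}}>0,\\ \delta T_{\max}(\gamma_i,\Lambda_i)& C(x,\eta)\ge V(x),\ -\epsilon_i+\epsilon_{\mathrm{ref}}\le0,\\ 0&C(x,\eta)<V(x)\end{cases}$$ (the quotient being $+\infty$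 if $V(x)=0$), and replace $\bar h$ by $\bar h_i$ if $\bar h_i>\bar h$; finally $\Gamma(x,\eta)=\bar h$. The reference-function mechanism uses the scalar variable $\eta\in\mathbb R$, $C(x,\eta)=\eta$ and $S(\eta,x)=e^{-\epsilon_{\mathrm{ref}}\Gamma(x,\eta)}\eta$. **Theorem.** Suppose that the conditions $(\epsilon_i,\gamma_i,L_i)$, $i=1,\dots,n_{\mathrm{par}}$, all hold for the same functions $V$ and $\alpha_w$, and that $\epsilon_1>0$. Consider $\mathcal H_{STC}$ with the reference-function mechanism, and its solutions with $\eta(0,0)=V(x(0,0))$. Then $t_{\min}>0$, any two consecutive sampling instants of any such solution satisfy $t_{j+1}-t_j\ge t_{\min}$, and $\mathcal H_{STC}$ is input-to-state stable: there are $\beta\in\mathcal{KLL}$ and $\psi\in\mathcal K_\infty$ such that, for every locally integrable $w$ and every solution with $\tau_{\max}(0,0)=\tau(0,0)\ge0$ and $\eta(0,0)=V(x(0,0))$, $$\left|\begin{pmatrix}x(t,j)\\e(t,j)\\\eta(t,j)\end{pmatrix}\right|\le\beta\left(\left|\begin{pmatrix}x(0,0)\\e(0,0)\\\eta(0,0)\end{pmatrix}\right|,t,j\right)+\psi(\|w\|_\infty)$$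 for all $(t,j)$ in the domain of the solution, where $\|w\|_\infty$ is the essential supremum of $|w|$ on $[0,\infty)$ (the bound being void if it is infinite). -/

import Mathlib

open scoped NNReal ENNReal Topology
open MeasureTheory Filter Set

noncomputable section

namespace DynSTC

/-! ### Comparison functions -/

/-- Class `𝒦`: continuous, strictly increasing, zero at zero. -/
def IsClassK (α : ℝ≥0 → ℝ≥0) : Prop :=
  Continuous α ∧ StrictMono α ∧ α 0 = 0

/-- Class `𝒦∞`: class `𝒦` and unbounded. -/
def IsClassKInf (α : ℝ≥0 → ℝ≥0) : Prop :=
  IsClassK α ∧ ∀ M : ℝ≥0, ∃ r : ℝ≥0, M < α r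

/-- Class `𝒦ℒ`: continuous, class `𝒦` in the first argument, nonincreasing with limit zero in the
second argument. -/
def IsClassKL (β : ℝ≥0 → ℝ≥0 → ℝ≥0) : Prop :=
  Continuous (fun p : ℝ≥0 × ℝ≥0 => β p.1 p.2) ∧
  (∀ t, IsClassK (fun q => β q t)) ∧
  ∀ q, Antitone (β q) ∧ Tendsto (β q) atTop (𝓝 0)

/-- Class `𝒦ℒℒ`. -/
def IsClassKLL (β : ℝ≥0 → ℝ≥0 → ℝ≥0 → ℝ≥0) : Prop :=
  ∀ r : ℝ≥0, IsClassKL (fun q s => β q r s) ∧ IsClassKL (fun q s => β q s r)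

/-! ### Hybrid systems and their solutions -/

/-- `D = ⋃_{j < J} [t_j, t_{j+1}] × {j}` with `0 = t_0 ≤ t_1 ≤ ⋯ ≤ t_J`. -/
def IsCompactHybridTimeDomain (D : Set (ℝ × ℕ)) : Prop :=
  ∃ (J : ℕ) (t : ℕ → ℝ), t 0 = 0 ∧ (∀ j < J, t j ≤ t (j + 1)) ∧
    D = {p : ℝ × ℕ | p.2 < J ∧ t p.2 ≤ p.1 ∧ p.1 ≤ t (p.2 + 1)}

/-- A hybrid time domain: a subset of `[0, ∞) × ℕ` all of whose truncations at points of the set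
are compact hybrid time domains. -/
def IsHybridTimeDomain (D : Set (ℝ × ℕ)) : Prop :=
  (∀ p ∈ D, 0 ≤ p.1) ∧
  ∀ p ∈ D, IsCompactHybridTimeDomain (D ∩ {q : ℝ × ℕ | 0 ≤ q.1 ∧ q.1 ≤ p.1 ∧ q.2 ≤ p.2})

/-- A hybrid trajectory: a function on a hybrid time domain that is (locally) absolutely continuous
in `t` for each fixed `j`. Only the values `ξ t j` with `(t, j) ∈ dom` are meaningful. -/
structure HybridTrajectory (E : Type*) [NormedAddCommGroup E] where
  /-- the hybrid time domain -/
  dom : Set (ℝ × ℕ)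
  /-- the function -/
  ξ : ℝ → ℕ → E
  isHybridTimeDomain : IsHybridTimeDomain dom
  absolutelyContinuous : ∀ (j : ℕ) (a b : ℝ), (a, j) ∈ dom → (b, j) ∈ dom →
    AbsolutelyContinuousOnInterval (fun t => ξ t j) a b

/-- The data `(F, G, C, D)` of a hybrid system with state space `E` and input space `Win`. -/
structure HybridSystem (E Win : Type*) where
  /-- flow map -/
  F : E → Win → E
  /-- jump map -/
  G : E → E
  /-- flow set -/
  C : Set E
  /-- jump set -/
  D : Set E

/-- `φ` is a solution to the hybrid system `H` for the locally integrable input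
`w : [0, ∞) → Win` (values of `w` at negative times play no role). -/
structure IsSolution {E Win : Type*} [NormedAddCommGroup E] [NormedSpace ℝ E]
    [NormedAddCommGroup Win] (H : HybridSystem E Win) (w : ℝ → Win)
    (φ : HybridTrajectory E) : Prop where
  locallyIntegrable : LocallyIntegrableOn w (Ici 0)
  flow : ∀ j : ℕ, ∀ᵐ t : ℝ, (t, j) ∈ φ.dom →
    φ.ξ t j ∈ H.C ∧ HasDerivAt (fun s => φ.ξ s j) (H.F (φ.ξ t j) (w t)) t
  jump : ∀ (t : ℝ) (j : ℕ), (t, j) ∈ φ.dom → (t, j + 1) ∈ φ.dom →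
    φ.ξ t j ∈ H.D ∧ φ.ξ t (j + 1) = H.G (φ.ξ t j)

/-! ### The self-triggered networked control system -/

/-- `ℝⁿ` with the Euclidean norm. -/
abbrev Vec (n : ℕ) := EuclideanSpace ℝ (Fin n)

/-- The space of the combined plant and controller states `x = (x_p, x_c)`, with the Euclidean
norm. The sampling-induced error `e` lives in the same space. -/
abbrev NCSVec (np nc : ℕ) := EuclideanSpace ℝ (Fin np ⊕ Fin nc)

/-- The plant component of a combined vector. -/
def plantPart {np nc : ℕ} (x : NCSVec np nc) : Vec np :=
  WithLp.toLp 2 fun i => x (Sum.inl i)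

/-- The controller component of a combined vector. -/
def ctrlPart {np nc : ℕ} (x : NCSVec np nc) : Vec nc :=
  WithLp.toLp 2 fun i => x (Sum.inr i)

/-- The right-hand side `f(x, e, w)` of the combined state: the plant
`ẋ_p = f_p(x_p, û, w)` and the controller `ẋ_c = f_c(x_c, x̂_p)`, `u = g_c(x_c, x_p)`, with the
held values `x̂ = x + e` and `û = g_c(x̂_c, x̂_p)`. -/
def closedLoop {np nc nu nw : ℕ} (fp : Vec np → Vec nu → Vec nw → Vec np)
    (fc : Vec nc → Vec np → Vec nc) (gc : Vec nc → Vec np → Vec nu)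
    (x e : NCSVec np nc) (w : Vec nw) : NCSVec np nc :=
  WithLp.toLp 2 <| Sum.elim
    (fp (plantPart x) (gc (ctrlPart x + ctrlPart e) (plantPart x + plantPart e)) w)
    (fc (ctrlPart x) (plantPart x + plantPart e))

/-- The state `ξ = (x, e, η, τ, τ_max)` of the hybrid system; `Y` is the space of `η`. -/
abbrev STCState (np nc : ℕ) (Y : Type*) := NCSVec np nc × NCSVec np nc × Y × ℝ × ℝ

section State

variable {np nc : ℕ} {Y : Type*}

/-- The component `x`. -/
def STCState.x (s : STCState np nc Y) : NCSVec np nc := s.1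

/-- The component `e`. -/
def STCState.e (s : STCState np nc Y) : NCSVec np nc := s.2.1

/-- The component `η`. -/
def STCState.η (s : STCState np nc Y) : Y := s.2.2.1

/-- The timer `τ`. -/
def STCState.τ (s : STCState np nc Y) : ℝ := s.2.2.2.1

/-- The component `τ_max`. -/
def STCState.τmax (s : STCState np nc Y) : ℝ := s.2.2.2.2

/-- The Euclidean norm of the stacked vector `(x, e, η)`. -/
def STCState.norm3 [NormedAddCommGroup Y] (s : STCState np nc Y) : ℝ≥0 :=
  NNReal.sqrt (‖STCState.x s‖₊ ^ 2 + ‖STCState.e s‖₊ ^ 2 + ‖STCState.η s‖₊ ^ 2)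

end State

/-- The hybrid system `H_STC` with update rule `S` of the dynamic variable and sampling-interval
function `Γ`. -/
def stcSystem {np nc nw : ℕ} {Y : Type*} [Zero Y]
    (f : NCSVec np nc → NCSVec np nc → Vec nw → NCSVec np nc)
    (S : Y → NCSVec np nc → Y) (Γ : NCSVec np nc → Y → ℝ) :
    HybridSystem (STCState np nc Y) (Vec nw) where
  F s w := (f s.x s.e w, -f s.x s.e w, 0, 1, 0)
  G s := (s.x, 0, S s.η s.x, 0, Γ s.x s.η)
  C := {s | s.τ ≤ s.τmax}
  D := {s | s.τ = s.τmax}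

/-- `‖w‖_∞`, the essential supremum of the Euclidean norm of `w` on `[0, ∞)`. -/
def supNorm {Win : Type*} [NormedAddCommGroup Win] (w : ℝ → Win) : ℝ≥0∞ :=
  eLpNorm w ∞ (volume.restrict (Ici (0 : ℝ)))

/-- Admissible initial states: `τ(0,0) = τ_max(0,0) ≥ 0` (so that the mechanism is executed at time
`0`), and the pair `(x(0,0), η(0,0))` satisfies the initialization rule `Init`. -/
def IsInitial {np nc : ℕ} {Y : Type*} (Init : NCSVec np nc → Y → Prop)
    (s : STCState np nc Y) : Prop :=
  0 ≤ s.τ ∧ s.τmax = s.τ ∧ Init s.x s.η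

/-- Input-to-state stability of `H`, for the initial states selected by `Init`. If `‖w‖_∞ = ∞`, the
bound is void, since the gain `ψ` is unbounded. -/
def IsISS {np nc nw : ℕ} {Y : Type*} [NormedAddCommGroup Y] [NormedSpace ℝ Y]
    (H : HybridSystem (STCState np nc Y) (Vec nw)) (Init : NCSVec np nc → Y → Prop) : Prop :=
  ∃ (β : ℝ≥0 → ℝ≥0 → ℝ≥0 → ℝ≥0) (ψ : ℝ≥0 → ℝ≥0), IsClassKLL β ∧ IsClassKInf ψ ∧
    ∀ (w : ℝ → Vec nw) (φ : HybridTrajectory (STCState np nc Y)), IsSolution H w φ →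
      IsInitial Init (φ.ξ 0 0) → supNorm w ≠ ∞ →
      ∀ (t : ℝ) (j : ℕ), (t, j) ∈ φ.dom →
        (φ.ξ t j).norm3 ≤ β (φ.ξ 0 0).norm3 t.toNNReal (j : ℝ≥0) + ψ (supNorm w).toNNReal

/-- `t` is the sampling instant `t_j`: the trajectory jumps from `(t, j)` to `(t, j + 1)`. -/
def IsSamplingInstant {E : Type*} [NormedAddCommGroup E] (φ : HybridTrajectory E) (j : ℕ)
    (t : ℝ) : Prop :=
  (t, j) ∈ φ.dom ∧ (t, j + 1) ∈ φ.dom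

/-! ### Hybrid Lyapunov functions -/

/-- The hybrid Lyapunov condition on `f` for the functions `V`, `α_w` and the parameters
`ε, γ, L`. The functions `W`, `H` and the `𝒦∞` bounds may depend on the parameters. The gradients
exist almost everywhere because `V` and `W` are locally Lipschitz. -/
def HybridLyapunov {np nc nw : ℕ}
    (f : NCSVec np nc → NCSVec np nc → Vec nw → NCSVec np nc)
    (V : NCSVec np nc → ℝ) (αw : ℝ≥0 → ℝ≥0) (ε γ L : ℝ) : Prop :=
  0 < L ∧ 0 < γ ∧ IsClassKInf αw ∧ LocallyLipschitz V ∧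
  (∃ αlow αup : ℝ≥0 → ℝ≥0, IsClassKInf αlow ∧ IsClassKInf αup ∧
    ∀ x, (αlow ‖x‖₊ : ℝ) ≤ V x ∧ V x ≤ αup ‖x‖₊) ∧
  ∃ (W : NCSVec np nc → ℝ) (H : NCSVec np nc → NCSVec np nc → Vec nw → ℝ),
    LocallyLipschitz W ∧
    (∃ αlow αup : ℝ≥0 → ℝ≥0, IsClassKInf αlow ∧ IsClassKInf αup ∧
      ∀ e, (αlow ‖e‖₊ : ℝ) ≤ W e ∧ W e ≤ αup ‖e‖₊) ∧
    Continuous (fun p : NCSVec np nc × NCSVec np nc × Vec nw => H p.1 p.2.1 p.2.2) ∧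
    (∀ x e w, 0 ≤ H x e w) ∧
    (∀ x w, ∀ᵐ e, inner ℝ (gradient W e) (-f x e w) ≤ L * W e + H x e w) ∧
    ∀ e w, ∀ᵐ x, inner ℝ (gradient V x) (f x e w) ≤
      -ε * V x - H x e w ^ 2 + γ ^ 2 * W e ^ 2 + αw ‖w‖₊

/-! ### The triggering algorithm -/

/-- The maximum sampling interval `T_max(γ, Λ)`. -/
def Tmax (γ Λ : ℝ) : ℝ :=
  let r := √|(γ / Λ) ^ 2 - 1|
  if Λ < γ then 1 / (Λ * r) * Real.arctan r
  else if γ = Λ then 1 / Λ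
  else 1 / (Λ * r) * Real.artanh r

/-- The interval `h̄_i` that the algorithm computes for a single parameter set `ε, γ, L` from the
numbers `V = V(x)` and `C = C(x, η)`. If `V = 0`, then `- log V = +∞`, so that the second entry of
the minimum imposes no restriction. -/
def candidate (δ εref ε γ L V C : ℝ) : ℝ :=
  let Λ := max (L + ε / 2) (1 - δ)
  if V ≤ C then
    if 0 < -ε + εref then
      if V = 0 then δ * Tmax γ Λ
      else min (δ * Tmax γ Λ) ((Real.log C - Real.log V) / (-ε + εref))
    else δ * Tmax γ Λ
  else 0

/-- The fall-back interval `t_min = δ T_max(γ₁, L₁ + ε₁/2)`. -/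
def fallback (δ ε₁ γ₁ L₁ : ℝ) : ℝ := δ * Tmax γ₁ (L₁ + ε₁ / 2)

/-- The sampling interval `Γ(x, η)` computed by the algorithm for the given function `C(x, η)`. The
parameter sets `1, …, n_par` are indexed by `0, …, n`, so the first one has index `0`, and the loop
runs through the indices `i.succ`, `i = 0, …, n - 1`. -/
def algGamma {X Y : Type*} {n : ℕ} (δ εref : ℝ) (ε γ L : Fin (n + 1) → ℝ) (V : X → ℝ)
    (C : X → Y → ℝ) (x : X) (η : Y) : ℝ :=
  (List.finRange n).foldl
    (fun h i =>
      let hi := candidate δ εref (ε i.succ) (γ i.succ) (L i.succ) (V x) (C x η)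
      if h < hi then hi else h)
    (fallback δ (ε 0) (γ 0) (L 0))

/-- `Γ` for the reference-function mechanism, i.e. with the scalar dynamic variable `η` and
`C(x, η) = η`. -/
def refGamma {X : Type*} {n : ℕ} (δ εref : ℝ) (ε γ L : Fin (n + 1) → ℝ) (V : X → ℝ) :
    X → ℝ → ℝ :=
  algGamma δ εref ε γ L V (fun _ η => η)

/-- The update rule `S(η, x) = exp(- ε_ref Γ(x, η)) η`. -/
def refUpdate {X : Type*} (εref : ℝ) (Γ : X → ℝ → ℝ) (η : ℝ) (x : X) : ℝ :=
  Real.exp (-εref * Γ x η) * η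

end DynSTC

end

open DynSTC

/-! Between samplings the relevant function is `U = V + γ φ(τ) W(e)²`, where `φ` solves the Riccati
equation `φ' = -2Λφ - γ(φ² + 1)`. Completing the square in `H` gives `U' ≤ -εU + αw(|w|)` as soon as
`Λ ≥ L + ε/2`. `Tmax γ Λ` is the time an explicit solution takes to fall from `+∞` to `0`, so on an
interval of length `δ * Tmax γ Λ` a solution can be kept above a positive constant. A jump resets
`e` to `0`, hence `U = V` there. Over a time `h` this yields `V ≤ exp(-εh) V(start)` plus a
disturbance term, and the lower bound on `φ` turns the same estimate into a bound on `e`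
(`exists_riccati_bound`, `HybridLyapunov.exists_flow_bound`).

The gradient inequalities hold only almost everywhere in state space, and a trajectory may stay
inside the exceptional null set. `LocallyLipschitz.hasDerivAt_comp_le_of_ae_inner_gradient_le`
recovers them along every curve by Fubini, using continuity of the right-hand sides.

At the sampling instants the reference variable equals `exp(-εref t) V(x(0,0))` exactly. The
mechanism leaves two cases (`refGamma_spec`): either the fallback interval is used and `V` contracts
by a fixed factor below one, or the interval satisfies `exp(-ε i h) V ≤ exp(-εref h) η`, so that the
next value of `V` exceeds the reference by at most one disturbance term, however large `V` was. The
bound `V ≤ exp(-ct) η₀ + D`, with `D` the fixed point of the fallback recursion, survives both cases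
(`storage_bound_step`). Since jumps are at least the fallback interval apart, half of the decay in
`t` can be traded for decay in `j` (`exists_decay_bound`). -/

/-! ### Absolutely continuous functions -/

namespace AbsolutelyContinuousOnInterval

theorem lipschitzOnWith_comp {X Y : Type*} [PseudoMetricSpace X] [PseudoMetricSpace Y]
    {U : X → Y} {f : ℝ → X} {a b : ℝ} {K : ℝ≥0} {s : Set X}
    (hf : AbsolutelyContinuousOnInterval f a b) (hU : LipschitzOnWith K U s)
    (hs : ∀ t ∈ uIcc a b, f t ∈ s) :
    AbsolutelyContinuousOnInterval (fun t => U (f t)) a b := by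
  rw [absolutelyContinuousOnInterval_iff] at hf ⊢
  intro ε hε
  obtain ⟨δ, hδ, h⟩ := hf (ε / (K + 1)) (by positivity)
  refine ⟨δ, hδ, fun E hE hlen => ?_⟩
  have h1 := h E hE hlen
  calc ∑ i ∈ Finset.range E.1, dist (U (f (E.2 i).1)) (U (f (E.2 i).2))
      ≤ ∑ i ∈ Finset.range E.1, (K : ℝ) * dist (f (E.2 i).1) (f (E.2 i).2) := by
        refine Finset.sum_le_sum fun i hi => ?_
        exact hU.dist_le_mul _ (hs _ (hE.1 i hi).1) _ (hs _ (hE.1 i hi).2)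
    _ = K * ∑ i ∈ Finset.range E.1, dist (f (E.2 i).1) (f (E.2 i).2) := by
        rw [Finset.mul_sum]
    _ ≤ (K + 1) * ∑ i ∈ Finset.range E.1, dist (f (E.2 i).1) (f (E.2 i).2) := by
        gcongr
        linarith
    _ < (K + 1) * (ε / (K + 1)) := by gcongr
    _ = ε := by field_simp

theorem locallyLipschitz_comp {X Y : Type*} [SeminormedAddCommGroup X] [PseudoMetricSpace Y]
    {U : X → Y} {f : ℝ → X} {a b : ℝ}
    (hf : AbsolutelyContinuousOnInterval f a b) (hU : LocallyLipschitz U) :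
    AbsolutelyContinuousOnInterval (fun t => U (f t)) a b := by
  have hc : IsCompact (f '' uIcc a b) := isCompact_uIcc.image_of_continuousOn hf.continuousOn
  obtain ⟨K, hK⟩ := hU.locallyLipschitzOn.exists_lipschitzOnWith_of_compact hc
  exact hf.lipschitzOnWith_comp hK (fun t ht => ⟨t, ht, rfl⟩)

theorem sub_le_mul_of_ae_deriv_le {f : ℝ → ℝ} {a b c : ℝ} (hab : a ≤ b)
    (hf : AbsolutelyContinuousOnInterval f a b)
    (h : ∀ᵐ t, t ∈ Icc a b → ∀ D, HasDerivAt f D t → D ≤ c) :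
    f b - f a ≤ c * (b - a) := by
  rw [← hf.integral_deriv_eq_sub]
  calc ∫ t in a..b, deriv f t ≤ ∫ _ in a..b, c := by
        refine intervalIntegral.integral_mono_ae_restrict hab hf.intervalIntegrable_deriv
          intervalIntegrable_const ?_
        rw [EventuallyLE, ae_restrict_iff' measurableSet_Icc]
        filter_upwards [h, hf.ae_differentiableAt] with t h1 h2 ht
        exact h1 ht _ (h2 (by rwa [uIcc_of_le hab])).hasDerivAt
    _ = c * (b - a) := by rw [intervalIntegral.integral_const, smul_eq_mul, mul_comm]

theorem eq_of_ae_hasDerivAt_const {f : ℝ → ℝ} {a b c : ℝ} (hab : a ≤ b)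
    (hf : AbsolutelyContinuousOnInterval f a b)
    (h : ∀ᵐ t, t ∈ Icc a b → HasDerivAt f c t) :
    f b = f a + c * (b - a) := by
  have h1 := hf.sub_le_mul_of_ae_deriv_le (c := c) hab (by
    filter_upwards [h] with t ht hm D hD
    exact ((ht hm).unique hD).ge)
  have h2 := hf.neg.sub_le_mul_of_ae_deriv_le (c := -c) hab (by
    filter_upwards [h] with t ht hm D hD
    exact ((ht hm).neg.unique hD).ge)
  simp only [Pi.neg_apply] at h2
  linarith

/-- A Grönwall inequality for a scalar linear differential inequality holding almost everywhere. -/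
theorem le_exp_mul_add {g : ℝ → ℝ} {a b ε A : ℝ} (hab : a ≤ b) (hA : 0 ≤ A)
    (hg : AbsolutelyContinuousOnInterval g a b)
    (h : ∀ᵐ t, t ∈ Icc a b → ∀ D, HasDerivAt g D t → D ≤ -ε * g t + A) :
    g b ≤ Real.exp (-ε * (b - a)) * g a + A * (b - a) * Real.exp (|ε| * (b - a)) := by
  -- Integrating factor, normalised to `1` at `b`. It is later bounded through `|ε|`, because `ε`
  -- may have either sign.
  have hexp : AbsolutelyContinuousOnInterval (fun t => Real.exp (ε * (t - b))) a b := by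
    have hC : ContDiff ℝ 1 (fun t => Real.exp (ε * (t - b))) := by fun_prop
    obtain ⟨K, hK⟩ := hC.locallyLipschitz.locallyLipschitzOn.exists_lipschitzOnWith_of_compact
      (isCompact_uIcc (a := a) (b := b))
    exact hK.absolutelyContinuousOnInterval
  have hder : ∀ t, HasDerivAt (fun t => Real.exp (ε * (t - b))) (ε * Real.exp (ε * (t - b))) t := by
    intro t
    have := (((hasDerivAt_id t).sub_const b).const_mul ε).exp
    simpa [mul_comm] using this
  have key := (hexp.fun_mul hg).sub_le_mul_of_ae_deriv_le (c := A * Real.exp (|ε| * (b - a))) hab (by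
    filter_upwards [h, hg.ae_differentiableAt] with t ht hd hm D hD
    have hgt := (hd (by rwa [uIcc_of_le hab])).hasDerivAt
    have h1 := ht hm _ hgt
    have h2 : D = ε * Real.exp (ε * (t - b)) * g t + Real.exp (ε * (t - b)) * deriv g t :=
      hD.unique ((hder t).mul hgt)
    have h3 : Real.exp (ε * (t - b)) ≤ Real.exp (|ε| * (b - a)) := by
      apply Real.exp_le_exp.mpr
      have h4 : ε * (t - b) ≤ |ε| * (b - t) := by
        have := mul_le_mul_of_nonneg_right (neg_abs_le ε) (sub_nonneg.2 hm.2)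
        nlinarith
      have h5 : |ε| * (b - t) ≤ |ε| * (b - a) := by
        gcongr
        exact hm.1
      linarith
    have h6 := Real.exp_pos (ε * (t - b))
    have h7 := mul_le_mul_of_nonneg_left h1 h6.le
    have h8 := mul_le_mul_of_nonneg_left h3 hA
    rw [h2]
    nlinarith)
  simp only [sub_self, mul_zero, Real.exp_zero, one_mul] at key
  have : Real.exp (ε * (a - b)) = Real.exp (-ε * (b - a)) := by congr 1; ring
  rw [this] at key
  linarith

end AbsolutelyContinuousOnInterval

/-! ### Almost everywhere gradient bounds for locally Lipschitz functions -/

section Gradient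

variable {E : Type*} [NormedAddCommGroup E] [InnerProductSpace ℝ E] [FiniteDimensional ℝ E]
  [MeasurableSpace E] [BorelSpace E]

/-- Almost every line parallel to `F x₀` meets the exceptional null set in a null set of parameters,
so the gradient bound can be integrated along it. Continuity of `U` then carries the increment bound
to the line through `x₀`, even if that line is exceptional. -/
theorem LocallyLipschitz.eventually_sub_le_of_ae_inner_gradient_le {U : E → ℝ}
    (hU : LocallyLipschitz U) {F : E → E} {G : E → ℝ} {x₀ : E} (hF : ContinuousAt F x₀)
    (hG : ContinuousAt G x₀) (h : ∀ᵐ x, inner ℝ (gradient U x) (F x) ≤ G x) {c : ℝ}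
    (hc : G x₀ < c) :
    ∀ᶠ s : ℝ in 𝓝[>] 0, U (x₀ + s • F x₀) - U x₀ ≤ c * s := by
  obtain ⟨K, T, hT, hK⟩ := hU x₀
  set v := F x₀ with hv
  -- Freezing the direction at `v` costs at most `K * ‖F x - v‖`, which the gap between `G x₀` and
  -- `c` absorbs near `x₀`.
  have hev : ∀ᶠ x in 𝓝 x₀, (K : ℝ) * ‖F x - v‖ + G x < c := by
    have h1 : ContinuousAt (fun x => (K : ℝ) * ‖F x - v‖ + G x) x₀ :=
      (((hF.sub continuousAt_const).norm).const_mul _).add hG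
    refine h1.eventually_lt continuousAt_const ?_
    simpa [hv] using hc
  obtain ⟨r, hr, hball⟩ := Metric.mem_nhds_iff.1 (inter_mem hT hev)
  have hKb : LipschitzOnWith K U (Metric.ball x₀ r) := hK.mono fun x hx => (hball hx).1
  let P : E → Prop := fun x => x ∈ Metric.ball x₀ r → DifferentiableAt ℝ U x ∧ fderiv ℝ U x v ≤ c
  have hP : ∀ᵐ x, P x := by
    filter_upwards [h, hKb.ae_differentiableWithinAt_of_mem (μ := volume)] with x h1 h2 hx
    have hn : Metric.ball x₀ r ∈ 𝓝 x := Metric.isOpen_ball.mem_nhds hx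
    have hd := (h2 hx).differentiableAt hn
    refine ⟨hd, ?_⟩
    rw [inner_gradient_left] at h1
    have h3 : ‖fderiv ℝ U x‖ ≤ K := norm_fderiv_le_of_lipschitzOn ℝ hn hKb
    have h4 : fderiv ℝ U x v = fderiv ℝ U x (F x) - fderiv ℝ U x (F x - v) := by
      rw [map_sub]; ring
    have h5 : -(fderiv ℝ U x (F x - v)) ≤ K * ‖F x - v‖ := by
      refine (neg_le_abs _).trans ?_
      exact (fderiv ℝ U x).le_of_opNorm_le h3 _
    have h6 : (K : ℝ) * ‖F x - v‖ + G x < c := (hball hx).2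
    linarith
  -- move along the direction `v` from almost every starting point
  obtain ⟨N, hNP, hNm, hN0⟩ : ∃ N, {x | ¬ P x} ⊆ N ∧ MeasurableSet N ∧ volume N = 0 := by
    obtain ⟨N, h1, h2, h3⟩ := exists_measurable_superset_of_null (ae_iff.1 hP)
    exact ⟨N, h1, h2, h3⟩
  have hfub : ∀ᵐ x : E, ∀ᵐ u : ℝ, x + u • v ∉ N := by
    have hmeas : MeasurableSet {p : E × ℝ | p.1 + p.2 • v ∉ N} := by
      have : Measurable (fun p : E × ℝ => p.1 + p.2 • v) := by fun_prop
      exact this hNm.compl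
    rw [Measure.ae_ae_comm (p := fun x u => x + u • v ∉ N) hmeas]
    refine Eventually.of_forall fun u => ?_
    have := (measurePreserving_add_right (volume : Measure E) (u • v)).quasiMeasurePreserving.ae
      (p := fun x => x ∉ N) (by rw [ae_iff]; simpa using hN0)
    exact this
  have hsmall : ∀ᶠ s : ℝ in 𝓝[>] 0, s * ‖v‖ < r / 2 := by
    have : ContinuousAt (fun s : ℝ => s * ‖v‖) 0 := by fun_prop
    exact (this.eventually_lt continuousAt_const (by simp; positivity)).filter_mono nhdsWithin_le_nhds
  filter_upwards [hsmall, self_mem_nhdsWithin] with s hs hs0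
  have hs0 : 0 < s := hs0
  have hgood : ∀ x ∈ Metric.ball x₀ (r / 2), (∀ᵐ u : ℝ, x + u • v ∉ N) →
      U (x + s • v) - U x ≤ c * s := by
    intro x hx hae
    have hin : ∀ u ∈ uIcc 0 s, x + u • v ∈ Metric.ball x₀ r := by
      intro u hu
      rw [uIcc_of_le hs0.le] at hu
      rw [Metric.mem_ball, dist_eq_norm] at hx ⊢
      have h1 : x + u • v - x₀ = (x - x₀) + u • v := by abel
      have h2 : ‖u • v‖ ≤ s * ‖v‖ := by
        rw [norm_smul, Real.norm_of_nonneg hu.1]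
        gcongr
        exact hu.2
      rw [h1]
      linarith [norm_add_le (x - x₀) (u • v)]
    have hline : AbsolutelyContinuousOnInterval (fun u : ℝ => x + u • v) 0 s := by
      have hC : LipschitzWith ‖v‖₊ (fun u : ℝ => x + u • v) := by
        refine LipschitzWith.of_dist_le_mul fun a b => ?_
        rw [dist_add_left, dist_eq_norm, ← sub_smul, norm_smul, mul_comm, Real.dist_eq]
        simp
      exact (hC.lipschitzOnWith).absolutelyContinuousOnInterval
    have hk := hline.lipschitzOnWith_comp hKb hin
    have := hk.sub_le_mul_of_ae_deriv_le (c := c) hs0.le (by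
      filter_upwards [hae] with u hu hm D hD
      have hPu : P (x + u • v) := by
        by_contra hcon
        exact hu (hNP hcon)
      obtain ⟨hd, hle⟩ := hPu (hin u (by rwa [uIcc_of_le hs0.le]))
      have hl : HasDerivAt (fun u : ℝ => x + u • v) v u := by
        simpa using ((hasDerivAt_id u).smul_const v).const_add x
      have := hd.hasFDerivAt.comp_hasDerivAt u hl
      rw [hD.unique this]
      exact hle)
    simpa using this
  -- Violating the inequality is an open condition on the starting point, so a violation at `x₀`
  -- would also occur at a nearby good point.
  by_contra hcon
  push Not at hcon
  have hopen : IsOpen ({x | c * s < U (x + s • v) - U x} ∩ Metric.ball x₀ (r / 2)) := by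
    refine IsOpen.inter (isOpen_lt continuous_const ?_) Metric.isOpen_ball
    have := hU.continuous
    fun_prop
  obtain ⟨x, hx1, hx2⟩ := (Measure.dense_of_ae hfub).inter_open_nonempty _ hopen
    ⟨x₀, hcon, Metric.mem_ball_self (by positivity)⟩
  exact absurd (hgood x hx1.2 hx2) (not_le.2 hx1.1)

/-- If `⟨∇U, F⟩ ≤ G` almost everywhere and `F`, `G` are continuous at `y t`, then the chain rule
inequality holds for `U` along any curve `y` with velocity `F (y t)` at `t`. -/
theorem LocallyLipschitz.hasDerivAt_comp_le_of_ae_inner_gradient_le {U : E → ℝ}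
    (hU : LocallyLipschitz U) {F : E → E} {G : E → ℝ} {y : ℝ → E} {t D : ℝ}
    (hF : ContinuousAt F (y t)) (hG : ContinuousAt G (y t))
    (h : ∀ᵐ x, inner ℝ (gradient U x) (F x) ≤ G x)
    (hy : HasDerivAt y (F (y t)) t) (hD : HasDerivAt (fun s => U (y s)) D t) :
    D ≤ G (y t) := by
  refine le_of_forall_gt_imp_ge_of_dense fun c hc => ?_
  obtain ⟨K, T, hT, hK⟩ := hU (y t)
  set v := F (y t) with hv
  have hline : HasDerivAt (fun s : ℝ => y t + (s - t) • v) v t := by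
    simpa using (((hasDerivAt_id t).sub_const t).smul_const v).const_add (y t)
  -- The curve and its tangent line differ by `o(s - t)`, and the Lipschitz bound passes this on to
  -- `U`; the curve may thus be replaced by the line.
  have hdiff : HasDerivAt (fun s => U (y t + (s - t) • v) - U (y s)) 0 t := by
    rw [hasDerivAt_iff_isLittleO]
    have h0 : HasDerivAt (fun s => (y t + (s - t) • v) - y s) (v - v) t := hline.sub hy
    rw [hasDerivAt_iff_isLittleO] at h0
    simp only [sub_self, smul_zero, sub_zero, zero_smul, add_zero] at h0 ⊢
    refine Asymptotics.IsBigO.trans_isLittleO ?_ h0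
    refine Asymptotics.IsBigO.of_bound K ?_
    have e1 : ∀ᶠ s in 𝓝 t, y s ∈ T := hy.continuousAt.eventually_mem hT
    have e2 : ∀ᶠ s in 𝓝 t, y t + (s - t) • v ∈ T :=
      hline.continuousAt.eventually_mem (by simpa using hT)
    filter_upwards [e1, e2] with s h1 h2
    have := hK.dist_le_mul _ h2 _ h1
    rwa [dist_eq_norm, dist_eq_norm] at this
  have hsum : HasDerivAt (fun s => U (y t + (s - t) • v)) D t := by
    have := hdiff.add hD
    simp only [zero_add] at this
    refine this.congr_of_eventuallyEq (Eventually.of_forall fun s => ?_)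
    simp
  have hslope := hsum.tendsto_slope.mono_left
    (nhdsWithin_mono t (show Ioi t ⊆ {t}ᶜ from fun s hs => ne_of_gt hs))
  refine le_of_tendsto hslope ?_
  have hev := hU.eventually_sub_le_of_ae_inner_gradient_le hF hG h hc
  have hshift : Tendsto (fun s : ℝ => s - t) (𝓝[>] t) (𝓝[>] 0) := by
    refine tendsto_nhdsWithin_iff.2 ⟨?_, ?_⟩
    · have : ContinuousAt (fun s : ℝ => s - t) t := by fun_prop
      have h2 := this.tendsto.mono_left (nhdsWithin_le_nhds (s := Ioi t))
      simpa using h2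
    · filter_upwards [self_mem_nhdsWithin] with s hs
      exact sub_pos.2 (mem_Ioi.1 hs)
  filter_upwards [hshift.eventually hev, self_mem_nhdsWithin] with s h1 h2
  have h2 : 0 < s - t := sub_pos.2 (mem_Ioi.1 h2)
  rw [slope_def_field, div_le_iff₀ h2]
  simpa using h1

end Gradient

/-! ### The Riccati equation behind the maximum sampling interval -/

namespace DynSTC

/-- The equation is solved explicitly by `Λ/γ * (r cot(Λrs) - 1)`, `1/(Λs) - 1` or `Λ/γ * (r
coth(Λrs) - 1)`. Each solution blows up at `0` and first vanishes at `Tmax γ Λ`, which is where the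
three formulas for `Tmax` come from. -/
theorem exists_riccati_on_Ioo {γ Λ : ℝ} (hγ : 0 < γ) (hΛ : 0 < Λ) :
    0 < Tmax γ Λ ∧ ∃ φ : ℝ → ℝ, ∀ s ∈ Ioo 0 (Tmax γ Λ),
      0 < φ s ∧ HasDerivAt φ (-2 * Λ * φ s - γ * (φ s ^ 2 + 1)) s := by
  rcases lt_trichotomy Λ γ with h | h | h
  · set r := √|(γ / Λ) ^ 2 - 1| with hr
    have hT : Tmax γ Λ = 1 / (Λ * r) * Real.arctan r := by simp [Tmax, h, hr]
    have h1 : 1 < γ / Λ := (one_lt_div hΛ).2 h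
    have h2 : 0 < (γ / Λ) ^ 2 - 1 := by nlinarith
    have hr2 : r ^ 2 = (γ / Λ) ^ 2 - 1 := by rw [hr, Real.sq_sqrt (abs_nonneg _), abs_of_pos h2]
    have hr0 : 0 < r := Real.sqrt_pos.2 (abs_pos.2 h2.ne')
    have ha : 0 < Real.arctan r := Real.arctan_pos.2 hr0
    refine ⟨by rw [hT]; positivity, fun s => Λ / γ * (r * (Real.cos (Λ * r * s) /
      Real.sin (Λ * r * s)) - 1), fun s hs => ?_⟩
    set θ := Λ * r * s with hθ
    have hθ0 : 0 < θ := mul_pos (mul_pos hΛ hr0) hs.1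
    have hθ1 : θ < Real.arctan r := by
      have := hs.2
      rw [hT, one_div, inv_mul_eq_div, lt_div_iff₀ (by positivity)] at this
      rw [hθ]; linarith
    have hθ2 : θ < Real.pi / 2 := hθ1.trans (Real.arctan_lt_pi_div_two r)
    have hsin : 0 < Real.sin θ := Real.sin_pos_of_pos_of_lt_pi hθ0 (by linarith [Real.pi_pos])
    have hcos : 0 < Real.cos θ := Real.cos_pos_of_mem_Ioo ⟨by linarith [Real.pi_pos], hθ2⟩
    have htan : Real.sin θ < r * Real.cos θ := by
      have := Real.tan_lt_tan_of_nonneg_of_lt_pi_div_two hθ0.le (Real.arctan_lt_pi_div_two r) hθ1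
      rwa [Real.tan_arctan, Real.tan_eq_sin_div_cos, div_lt_iff₀ hcos] at this
    constructor
    · refine mul_pos (by positivity) ?_
      rw [sub_pos, ← mul_div_assoc, one_lt_div hsin]
      exact htan
    · have hl : HasDerivAt (fun s : ℝ => Λ * r * s) (Λ * r) s := by
        simpa using (hasDerivAt_id s).const_mul (Λ * r)
      have hd := (((hl.cos.div hl.sin hsin.ne').const_mul r).sub_const 1).const_mul (Λ / γ)
      refine hd.congr_deriv ?_
      simp only [← hθ]
      have hγ2 : γ ^ 2 = (r ^ 2 + 1) * Λ ^ 2 := by rw [hr2]; field_simp; ring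
      field_simp
      rw [hγ2]
      ring
  · subst h
    have hT : Tmax Λ Λ = 1 / Λ := by simp [Tmax]
    refine ⟨by rw [hT]; positivity, fun s => 1 / (Λ * s) - 1, fun s hs => ?_⟩
    have hs1 : s * Λ < 1 := by
      have := hs.2
      rwa [hT, lt_div_iff₀ hΛ] at this
    have hs0 := hs.1
    constructor
    · rw [sub_pos, one_lt_div (by positivity)]
      linarith
    · have hl : HasDerivAt (fun s : ℝ => Λ * s) Λ s := by
        simpa using (hasDerivAt_id s).const_mul Λ
      have hd := (hl.inv (by positivity)).sub_const 1
      simp only [one_div]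
      refine hd.congr_deriv ?_
      field_simp
      ring
  · set r := √|(γ / Λ) ^ 2 - 1| with hr
    have hT : Tmax γ Λ = 1 / (Λ * r) * Real.artanh r := by
      simp [Tmax, h.not_gt, h.ne, hr]
    have h0 : 0 < γ / Λ := by positivity
    have h1 : γ / Λ < 1 := (div_lt_one hΛ).2 h
    have h2 : 0 < 1 - (γ / Λ) ^ 2 := by nlinarith
    have hr2 : r ^ 2 = 1 - (γ / Λ) ^ 2 := by
      rw [hr, Real.sq_sqrt (abs_nonneg _), abs_of_neg (by linarith)]; ring
    have hr0 : 0 < r := Real.sqrt_pos.2 (abs_pos.2 (by linarith))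
    have hr1 : r < 1 := by
      have : 0 < (γ / Λ) ^ 2 := by positivity
      nlinarith
    have ha : 0 < Real.artanh r := Real.artanh_pos ⟨hr0, hr1⟩
    refine ⟨by rw [hT]; positivity, fun s => Λ / γ * (r * (Real.cosh (Λ * r * s) /
      Real.sinh (Λ * r * s)) - 1), fun s hs => ?_⟩
    set θ := Λ * r * s with hθ
    have hθ0 : 0 < θ := mul_pos (mul_pos hΛ hr0) hs.1
    have hθ1 : θ < Real.artanh r := by
      have := hs.2
      rw [hT, one_div, inv_mul_eq_div, lt_div_iff₀ (by positivity)] at this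
      rw [hθ]; linarith
    have hsinh : 0 < Real.sinh θ := Real.sinh_pos_iff.2 hθ0
    have hcosh : 0 < Real.cosh θ := Real.cosh_pos θ
    have htanh : Real.sinh θ < r * Real.cosh θ := by
      by_contra hcon
      have h3 : r ≤ Real.tanh θ := by
        rw [Real.tanh_eq_sinh_div_cosh, le_div_iff₀ hcosh]
        linarith
      have h4 := Real.artanh_le_artanh (by linarith) (Real.tanh_lt_one θ) h3
      rw [Real.artanh_tanh] at h4
      linarith
    constructor
    · refine mul_pos (by positivity) ?_
      rw [sub_pos, ← mul_div_assoc, one_lt_div hsinh]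
      exact htanh
    · have hl : HasDerivAt (fun s : ℝ => Λ * r * s) (Λ * r) s := by
        simpa using (hasDerivAt_id s).const_mul (Λ * r)
      have hd := (((hl.cosh.div hl.sinh hsinh.ne').const_mul r).sub_const 1).const_mul (Λ / γ)
      refine hd.congr_deriv ?_
      simp only [← hθ]
      have hγ2 : γ ^ 2 = (1 - r ^ 2) * Λ ^ 2 := by rw [hr2]; field_simp; ring
      field_simp
      rw [hγ2]
      ring

theorem Tmax_pos {γ Λ : ℝ} (hγ : 0 < γ) (hΛ : 0 < Λ) : 0 < Tmax γ Λ :=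
  (exists_riccati_on_Ioo hγ hΛ).1

theorem exists_riccati {γ Λ δ : ℝ} (hγ : 0 < γ) (hΛ : 0 < Λ) (hδ : δ ∈ Ioo (0 : ℝ) 1) :
    ∃ φ : ℝ → ℝ, ∀ s ∈ Icc 0 (δ * Tmax γ Λ),
      0 < φ s ∧ HasDerivAt φ (-2 * Λ * φ s - γ * (φ s ^ 2 + 1)) s := by
  obtain ⟨hT, φ, hφ⟩ := exists_riccati_on_Ioo hγ hΛ
  -- Half of the spare length: shifting by `c` moves the closed interval into `[c, Tmax - c]`, away
  -- from both the pole and the zero.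
  set c := (1 - δ) * Tmax γ Λ / 2 with hc
  have hc0 : 0 < c := by have := sub_pos.2 hδ.2; positivity
  refine ⟨fun s => φ (s + c), fun s hs => ?_⟩
  obtain ⟨h1, h2⟩ := hφ (s + c) ⟨by linarith [hs.1], by
    have := hs.2
    have h3 : δ * Tmax γ Λ + c = Tmax γ Λ - c := by rw [hc]; ring
    linarith⟩
  exact ⟨h1, h2.comp_add_const s c⟩

/-- Existence of the weight used in the Lyapunov function `V + γ φ(τ) W²`, together with a
uniform positive lower bound on its range. -/
theorem exists_riccati_bound {γ Λ δ : ℝ} (hγ : 0 < γ) (hΛ : 0 < Λ) (hδ : δ ∈ Ioo (0 : ℝ) 1) :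
    ∃ (φ : ℝ → ℝ) (m : ℝ), 0 < m ∧ ∀ s ∈ Icc 0 (δ * Tmax γ Λ),
      m ≤ φ s ∧ HasDerivAt φ (-2 * Λ * φ s - γ * (φ s ^ 2 + 1)) s := by
  obtain ⟨φ, hφ⟩ := exists_riccati hγ hΛ hδ
  have hne : (Icc 0 (δ * Tmax γ Λ)).Nonempty :=
    nonempty_Icc.2 (mul_nonneg hδ.1.le (Tmax_pos hγ hΛ).le)
  obtain ⟨s₀, hs₀, hmin⟩ := isCompact_Icc.exists_isMinOn hne
    (fun s hs => (hφ s hs).2.continuousAt.continuousWithinAt)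
  exact ⟨φ, φ s₀, (hφ s₀ hs₀).1, fun s hs => ⟨hmin hs, (hφ s hs).2⟩⟩

/-! ### Comparison functions -/

theorem IsClassKInf.comp {α β : ℝ≥0 → ℝ≥0} (hα : IsClassKInf α) (hβ : IsClassKInf β) :
    IsClassKInf (fun r => α (β r)) := by
  refine ⟨⟨hα.1.1.comp hβ.1.1, hα.1.2.1.comp hβ.1.2.1, by simp [hβ.1.2.2, hα.1.2.2]⟩, fun M => ?_⟩
  obtain ⟨s, hs⟩ := hα.2 M
  obtain ⟨r, hr⟩ := hβ.2 s
  exact ⟨r, hs.trans (hα.1.2.1 hr)⟩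

theorem IsClassKInf.add {α β : ℝ≥0 → ℝ≥0} (hα : IsClassKInf α) (hβ : IsClassKInf β) :
    IsClassKInf (fun r => α r + β r) := by
  refine ⟨⟨hα.1.1.add hβ.1.1, hα.1.2.1.add hβ.1.2.1, by simp [hβ.1.2.2, hα.1.2.2]⟩, fun M => ?_⟩
  obtain ⟨r, hr⟩ := hα.2 M
  exact ⟨r, hr.trans_le le_self_add⟩

theorem isClassKInf_id : IsClassKInf (fun r => r) :=
  ⟨⟨continuous_id, strictMono_id, rfl⟩, fun M => ⟨M + 1, by simp⟩⟩

theorem isClassKInf_mul {c : ℝ≥0} (hc : 0 < c) : IsClassKInf (fun r => c * r) := by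
  refine ⟨⟨by fun_prop, fun a b h => by dsimp only; gcongr, by simp⟩, fun M => ⟨(M + 1) / c, ?_⟩⟩
  dsimp only
  rw [mul_div_cancel₀ _ hc.ne']
  simp

theorem isClassKInf_sqrt : IsClassKInf NNReal.sqrt := by
  refine ⟨⟨NNReal.continuous_sqrt, fun a b h => NNReal.sqrt_lt_sqrt.2 h, by simp⟩,
    fun M => ⟨(M + 1) ^ 2, ?_⟩⟩
  rw [NNReal.sqrt_sq]
  simp

/-- The identity summand keeps the empty sum in class `𝒦∞`, which gives the induction its base case.
-/
theorem isClassKInf_add_sum {ι : Type*} (s : Finset ι) {σ : ι → ℝ≥0 → ℝ≥0}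
    (h : ∀ i ∈ s, IsClassKInf (σ i)) : IsClassKInf (fun r => r + ∑ i ∈ s, σ i r) := by
  classical
  induction s using Finset.induction_on with
  | empty => simpa using isClassKInf_id
  | insert i s hi ih =>
    have h1 := (ih fun k hk => h k (Finset.mem_insert_of_mem hk)).add
      (h i (Finset.mem_insert_self i s))
    refine cast (congrArg IsClassKInf (funext fun r => ?_)) h1
    rw [Finset.sum_insert hi, add_assoc, add_comm (∑ k ∈ s, σ k r)]

theorem IsClassKInf.exists_inverse {α : ℝ≥0 → ℝ≥0} (hα : IsClassKInf α) :
    ∃ σ, IsClassKInf σ ∧ ∀ r s, α r ≤ s → r ≤ σ s := by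
  have hsurj : Function.Surjective α := fun y => by
    obtain ⟨r, hr⟩ := hα.2 y
    exact mem_range_of_exists_le_of_exists_ge hα.1.1 ⟨0, by simp [hα.1.2.2]⟩ ⟨r, hr.le⟩
  let o := hα.1.2.1.orderIsoOfSurjective α hsurj
  have ho : ∀ r, o r = α r := fun r => rfl
  refine ⟨o.symm, ⟨⟨o.symm.continuous, o.symm.strictMono, o.symm.map_bot⟩, fun M => ?_⟩, ?_⟩
  · exact ⟨o (M + 1), by simp⟩
  · intro r s h
    rw [← ho] at h
    exact (o.le_symm_apply).2 h

/-- The sum is at most twice the larger argument. This separates the initial-state part from the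
disturbance part. -/
theorem IsClassKInf.map_add_le {σ : ℝ≥0 → ℝ≥0} (hσ : IsClassKInf σ) (a b : ℝ≥0) :
    σ (a + b) ≤ σ (2 * a) + σ (2 * b) := by
  rcases le_total a b with h | h
  · exact (hσ.1.2.1.monotone (by rw [two_mul]; gcongr)).trans le_add_self
  · exact (hσ.1.2.1.monotone (by rw [two_mul]; gcongr)).trans le_self_add

/-- Exponential decay composed with class `𝒦∞` functions is of class `𝒦ℒℒ`. -/
theorem isClassKLL_exp {σ κ : ℝ≥0 → ℝ≥0} (hσ : IsClassKInf σ) (hκ : IsClassKInf κ) {a b : ℝ≥0}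
    (ha : 0 < a) (hb : 0 < b) :
    IsClassKLL (fun q t j => σ (κ q * (Real.exp (-(a * t + b * j))).toNNReal)) := by
  -- Whichever of the two time arguments is frozen, it only contributes the constant `d` to the
  -- exponent.
  have key : ∀ {c : ℝ≥0} (d : ℝ), 0 < c →
      IsClassKL (fun q s => σ (κ q * (Real.exp (-(c * s + d))).toNNReal)) := by
    intro c d hc
    have hpos : ∀ s : ℝ≥0, 0 < (Real.exp (-(c * s + d))).toNNReal := fun s =>
      Real.toNNReal_pos.2 (Real.exp_pos _)
    refine ⟨?_, fun t => ⟨?_, ?_, ?_⟩, fun q => ⟨?_, ?_⟩⟩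
    · have := hσ.1.1
      have := hκ.1.1
      fun_prop
    · have := hσ.1.1
      have := hκ.1.1
      fun_prop
    · intro q q' h
      exact hσ.1.2.1 (mul_lt_mul_of_pos_right (hκ.1.2.1 h) (hpos t))
    · simp [hσ.1.2.2, hκ.1.2.2]
    · intro s s' h
      refine hσ.1.2.1.monotone ?_
      gcongr
    · have h1 : Tendsto (fun s : ℝ≥0 => Real.exp (-(c * s + d))) atTop (𝓝 0) := by
        refine Real.tendsto_exp_neg_atTop_nhds_zero.comp ?_
        refine tendsto_atTop_add_const_right _ _ ?_
        exact Tendsto.const_mul_atTop (NNReal.coe_pos.2 hc) (NNReal.tendsto_coe_atTop.2 tendsto_id)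
      have h2 := (tendsto_real_toNNReal h1).const_mul (κ q)
      have h3 := (hσ.1.1.tendsto _).comp h2
      simpa [hσ.1.2.2, Function.comp_def] using h3
  intro r
  refine ⟨?_, key (b * r) ha⟩
  have := key (a * r) hb
  simp only [add_comm (b * _ : ℝ)] at this
  exact this

/-! ### Growth of the storage function between two sampling instants -/

theorem IsClassKInf.map_zero {α : ℝ≥0 → ℝ≥0} (h : IsClassKInf α) : α 0 = 0 := h.1.2.2

/-- Between two sampling instants, `V` and the sampling-induced error are bounded by means of the
function `V + γ φ(τ) W²`. -/
theorem HybridLyapunov.exists_flow_bound {np nc nw : ℕ}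
    {f : NCSVec np nc → NCSVec np nc → Vec nw → NCSVec np nc}
    (hf : Continuous (fun p : NCSVec np nc × NCSVec np nc × Vec nw => f p.1 p.2.1 p.2.2))
    {V : NCSVec np nc → ℝ} {αw : ℝ≥0 → ℝ≥0} {ε γ L : ℝ} (h : HybridLyapunov f V αw ε γ L)
    {Λ δ : ℝ} (hΛ : 0 < Λ) (hLΛ : L + ε / 2 ≤ Λ) (hδ : δ ∈ Ioo (0 : ℝ) 1) :
    ∃ σ, IsClassKInf σ ∧ ∀ (x e : ℝ → NCSVec np nc) (w : ℝ → Vec nw) (a b A : ℝ), a ≤ b →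
      b - a ≤ δ * Tmax γ Λ → 0 ≤ A → AbsolutelyContinuousOnInterval x a b →
      AbsolutelyContinuousOnInterval e a b → e a = 0 →
      (∀ᵐ t, t ∈ Icc a b → (αw ‖w t‖₊ : ℝ) ≤ A ∧ HasDerivAt x (f (x t) (e t) (w t)) t ∧
        HasDerivAt e (-f (x t) (e t) (w t)) t) →
      V (x b) ≤ Real.exp (-ε * (b - a)) * V (x a) + A * (b - a) * Real.exp (|ε| * (b - a)) ∧
      ‖e b‖₊ ≤ σ (Real.exp (-ε * (b - a)) * V (x a) +
        A * (b - a) * Real.exp (|ε| * (b - a))).toNNReal := by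
  obtain ⟨-, hγ, -, hVL, ⟨αV, αV', -, -, hV⟩, W, H, hWL, ⟨αW, αW', hαW, hαW', hW⟩, hH, hH0, hWd,
    hVd⟩ := h
  obtain ⟨φ, m, hm, hφ⟩ := exists_riccati_bound hγ hΛ hδ
  obtain ⟨σ, hσ, hσi⟩ := hαW.exists_inverse
  -- From `φ ≥ m` follows `W² ≤ (γ m)⁻¹ U`; the error gain is the square root of this followed by
  -- the inverse of `αW`.
  have hc : 0 < (γ * m)⁻¹.toNNReal := Real.toNNReal_pos.2 (by positivity)
  refine ⟨_, hσ.comp (isClassKInf_sqrt.comp (isClassKInf_mul hc)), ?_⟩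
  intro x e w a b A hab hT hA hx he hea hae
  have hIcc : ∀ t ∈ Icc a b, t - a ∈ Icc 0 (δ * Tmax γ Λ) := fun t ht =>
    ⟨sub_nonneg.2 ht.1, (sub_le_sub_right ht.2 a).trans hT⟩
  have hW0 : ∀ z, 0 ≤ W z := fun z => (NNReal.coe_nonneg _).trans (hW z).1
  have hφt : ∀ t ∈ Icc a b, HasDerivAt (fun t => φ (t - a))
      (-2 * Λ * φ (t - a) - γ * (φ (t - a) ^ 2 + 1)) t := fun t ht =>
    (hφ _ (hIcc t ht)).2.comp_sub_const t a
  have hφc : ContinuousOn (fun t => φ (t - a)) (Icc a b) := fun t ht =>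
    (hφt t ht).continuousAt.continuousWithinAt
  have hφAC : AbsolutelyContinuousOnInterval (fun t => φ (t - a)) a b := by
    obtain ⟨C, hC⟩ := (isCompact_Icc (a := a) (b := b)).exists_bound_of_continuousOn
      (f := fun t => -2 * Λ * φ (t - a) - γ * (φ (t - a) ^ 2 + 1))
      ((continuousOn_const.mul hφc).sub (continuousOn_const.mul ((hφc.pow 2).add continuousOn_const)))
    refine LipschitzOnWith.absolutelyContinuousOnInterval (K := C.toNNReal) ?_
    rw [uIcc_of_le hab]
    refine (convex_Icc a b).lipschitzOnWith_of_nnnorm_hasDerivWithin_le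
      (fun t ht => (hφt t ht).hasDerivWithinAt) fun t ht => ?_
    rw [← NNReal.coe_le_coe]
    exact (hC t ht).trans (Real.le_coe_toNNReal C)
  have hVAC := hx.locallyLipschitz_comp hVL
  have hWAC := he.locallyLipschitz_comp hWL
  have hUAC := hVAC.fun_add ((hφAC.fun_mul (hWAC.fun_mul hWAC)).const_mul γ)
  have key := hUAC.le_exp_mul_add (ε := ε) (A := A) hab hA (by
    filter_upwards [hae, hVAC.ae_differentiableAt, hWAC.ae_differentiableAt] with t h1 h2 h3 ht D hD
    obtain ⟨hw, hxt, het⟩ := h1 ht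
    have ht' : t ∈ uIcc a b := by rwa [uIcc_of_le hab]
    have hV' := (h2 ht').hasDerivAt
    have hW' := (h3 ht').hasDerivAt
    have hDeq := hD.unique (hV'.add (((hφt t ht).mul (hW'.mul hW')).const_mul γ))
    -- The null set depends on the frozen arguments, so `e t` and `w t` are fixed at this one time
    -- `t`. No regularity of `w` in time is needed.
    have bV := hVL.hasDerivAt_comp_le_of_ae_inner_gradient_le
      (F := fun z => f z (e t) (w t))
      (G := fun z => -ε * V z - H z (e t) (w t) ^ 2 + γ ^ 2 * W (e t) ^ 2 + αw ‖w t‖₊)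
      (by
        have : Continuous (fun z => f z (e t) (w t)) :=
          hf.comp (by fun_prop : Continuous fun z => (z, e t, w t))
        exact this.continuousAt)
      (by
        have h4 : Continuous (fun z => H z (e t) (w t)) :=
          hH.comp (by fun_prop : Continuous fun z => (z, e t, w t))
        have h5 := hVL.continuous
        exact Continuous.continuousAt (by fun_prop))
      (hVd (e t) (w t)) hxt hV'
    have bW := hWL.hasDerivAt_comp_le_of_ae_inner_gradient_le
      (F := fun z => -f (x t) z (w t)) (G := fun z => L * W z + H (x t) z (w t))
      (by
        have : Continuous (fun z => f (x t) z (w t)) :=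
          hf.comp (by fun_prop : Continuous fun z => (x t, z, w t))
        exact this.neg.continuousAt)
      (by
        have h4 : Continuous (fun z => H (x t) z (w t)) :=
          hH.comp (by fun_prop : Continuous fun z => (x t, z, w t))
        have h5 := hWL.continuous
        exact Continuous.continuousAt (by fun_prop))
      (hWd (x t) (w t)) het hW'
    have hφ0 : 0 < φ (t - a) := hm.trans_le (hφ _ (hIcc t ht)).1
    rw [hDeq, Pi.mul_apply]
    generalize deriv (fun t => V (x t)) t = DV at bV ⊢
    generalize deriv (fun t => W (e t)) t = DW at bW ⊢
    have hWt := hW0 (e t)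
    generalize hP : φ (t - a) = p at hφ0 ⊢
    generalize W (e t) = W₀ at bV bW hWt ⊢
    generalize H (x t) (e t) (w t) = H₀ at bV bW
    -- The weight `2γpW₀` comes from differentiating `W²`. The Riccati equation cancels the terms in
    -- `γ²W²` and `γ²p²W²`, the slack `2Λ - 2L - ε ≥ 0` supplies `-εγpW²`, and the cross term in `H`
    -- is absorbed by the square `(H₀ - γpW₀)²`.
    have k1 := mul_le_mul_of_nonneg_left bW (by positivity : 0 ≤ 2 * γ * p * W₀)
    have k2 : 0 ≤ γ * p * W₀ ^ 2 * (2 * Λ - 2 * L - ε) := by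
      have : 0 ≤ 2 * Λ - 2 * L - ε := by linarith
      positivity
    nlinarith [sq_nonneg (H₀ - γ * p * W₀)])
  simp only [hea, sub_self] at key
  -- The initial error vanishes, so the weighted function starts at `V (x a)`, whatever the value `φ
  -- 0`.
  have hWz : W 0 = 0 := by
    refine le_antisymm ?_ (hW0 0)
    have := (hW 0).2
    simpa [hαW'.map_zero] using this
  simp only [hWz, mul_zero, add_zero] at key
  set Z := Real.exp (-ε * (b - a)) * V (x a) + A * (b - a) * Real.exp (|ε| * (b - a)) with hZ
  have hmb : m ≤ φ (b - a) := (hφ _ (hIcc b ⟨hab, le_rfl⟩)).1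
  have hVb : 0 ≤ V (x b) := (NNReal.coe_nonneg _).trans (hV _).1
  have hpos : 0 ≤ γ * (φ (b - a) * (W (e b) * W (e b))) := by
    have := hm.trans_le hmb
    have := hW0 (e b)
    positivity
  refine ⟨by linarith, hσi _ _ ?_⟩
  rw [NNReal.le_sqrt_iff_sq_le, ← NNReal.coe_le_coe]
  have h1 : γ * (m * (W (e b) * W (e b))) ≤ Z := by
    have : γ * (m * (W (e b) * W (e b))) ≤ γ * (φ (b - a) * (W (e b) * W (e b))) := by
      have := hW0 (e b)
      gcongr
    linarith
  have h2 : (αW ‖e b‖₊ : ℝ) ^ 2 ≤ W (e b) ^ 2 := by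
    gcongr
    exact (hW _).1
  push_cast
  rw [Real.coe_toNNReal _ (by positivity), Real.coe_toNNReal _ (by linarith)]
  rw [inv_mul_eq_div, le_div_iff₀ (by positivity)]
  nlinarith [mul_le_mul_of_nonneg_left h2 (by positivity : 0 ≤ γ * m)]

/-! ### Structure of the solutions -/

/-- Index convention: the interval with jump counter `k` is `[s k, s (k + 1)]`, so the sampling
instant number `k` is `s (k + 1)` and `s 0` is only the initial time. -/
theorem IsHybridTimeDomain.exists_jumpTimes {D : Set (ℝ × ℕ)} (hD : IsHybridTimeDomain D) {T : ℝ}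
    {j : ℕ} (hT : (T, j) ∈ D) :
    ∃ s : ℕ → ℝ, s 0 = 0 ∧ s (j + 1) = T ∧ (∀ k ≤ j, s k ≤ s (k + 1)) ∧
      (∀ k ≤ j, ∀ u ∈ Icc (s k) (s (k + 1)), (u, k) ∈ D) ∧
      ∀ k ≤ j, ∀ u ≤ T, (u, k) ∈ D → u ∈ Icc (s k) (s (k + 1)) := by
  obtain ⟨J, s, hs0, hs, hE⟩ := hD.2 _ hT
  have hmem : ∀ u k, ((u, k) ∈ D ∧ 0 ≤ u ∧ u ≤ T ∧ k ≤ j) ↔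
      (k < J ∧ s k ≤ u ∧ u ≤ s (k + 1)) := fun u k => by
    have := Set.ext_iff.1 hE (u, k)
    simpa using this
  have hTj := (hmem T j).1 ⟨hT, hD.1 _ hT, le_rfl, le_rfl⟩
  -- A further interval would contain its own left endpoint, a point with counter `j + 1` in a
  -- truncation that stops at `j`.
  have hJ : J = j + 1 := by
    by_contra hne
    have hlt : j + 1 < J := lt_of_le_of_ne hTj.1 (Ne.symm hne)
    have := (hmem (s (j + 1)) (j + 1)).2 ⟨hlt, le_rfl, hs _ hlt⟩
    omega
  subst hJ
  have hlast := (hmem (s (j + 1)) j).2 ⟨hTj.1, hs j hTj.1, le_rfl⟩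
  exact ⟨s, hs0, le_antisymm hlast.2.2.1 hTj.2.2, fun k hk => hs k (by omega),
    fun k hk u hu => ((hmem u k).2 ⟨by omega, hu.1, hu.2⟩).1,
    fun k hk u hu hmu => ((hmem u k).1 ⟨hmu, hD.1 _ hmu, hu, hk⟩).2⟩

section Solutions

variable {np nc nw : ℕ} {f : NCSVec np nc → NCSVec np nc → Vec nw → NCSVec np nc}
  {S : ℝ → NCSVec np nc → ℝ} {Γ : NCSVec np nc → ℝ → ℝ} {w : ℝ → Vec nw}
  {φ : HybridTrajectory (STCState np nc ℝ)}

theorem IsSolution.timers_of_flow (hφ : IsSolution (stcSystem f S Γ) w φ) {j : ℕ} {a b : ℝ}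
    (hab : a ≤ b) (hdom : ∀ u ∈ Icc a b, (u, j) ∈ φ.dom) :
    (φ.ξ b j).η = (φ.ξ a j).η ∧ (φ.ξ b j).τ = (φ.ξ a j).τ + (b - a) ∧
      (φ.ξ b j).τmax = (φ.ξ a j).τmax := by
  have hAC := φ.absolutelyContinuous j a b (hdom a (left_mem_Icc.2 hab)) (hdom b (right_mem_Icc.2 hab))
  have hder := hφ.flow j
  have h1 : LipschitzWith 1 (fun s : STCState np nc ℝ => s.2.2) :=
    (LipschitzWith.prod_snd.comp LipschitzWith.prod_snd).weaken (by simp)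
  have key : ∀ {g : ℝ × ℝ × ℝ → ℝ} {c : ℝ}, LipschitzWith 1 g →
      (∀ᵐ t, t ∈ Icc a b → HasDerivAt (fun t => g (φ.ξ t j).2.2) c t) →
      g (φ.ξ b j).2.2 = g (φ.ξ a j).2.2 + c * (b - a) := fun {g c} hg h =>
    AbsolutelyContinuousOnInterval.eq_of_ae_hasDerivAt_const hab
      (hAC.lipschitzOnWith_comp ((hg.comp h1).lipschitzOnWith (s := univ)) fun _ _ => mem_univ _) h
  have d : ∀ᵐ t, t ∈ Icc a b → HasDerivAt (fun t => (φ.ξ t j).2.2) (0, 1, 0) t := by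
    filter_upwards [hder] with t ht hm
    exact (ht (hdom t hm)).2.snd.snd
  refine ⟨?_, ?_, ?_⟩
  · have := key (g := fun p => p.1) (c := 0) LipschitzWith.prod_fst (by
      filter_upwards [d] with t ht hm
      exact (ht hm).fst)
    simpa [STCState.η] using this
  · have := key (g := fun p => p.2.1) (c := 1)
      ((LipschitzWith.prod_fst.comp LipschitzWith.prod_snd).weaken (by simp)) (by
      filter_upwards [d] with t ht hm
      exact (ht hm).snd.fst)
    simpa [STCState.τ] using this
  · have := key (g := fun p => p.2.2) (c := 0)
      ((LipschitzWith.prod_snd.comp LipschitzWith.prod_snd).weaken (by simp)) (by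
      filter_upwards [d] with t ht hm
      exact (ht hm).snd.snd)
    simpa [STCState.τmax] using this

theorem IsSolution.tau_le_of_flow (hφ : IsSolution (stcSystem f S Γ) w φ) {j : ℕ} {a b : ℝ}
    (hab : a < b) (hdom : ∀ u ∈ Icc a b, (u, j) ∈ φ.dom) :
    (φ.ξ a j).τ + (b - a) ≤ (φ.ξ a j).τmax := by
  by_contra! hcon
  have hae : ∀ᵐ t : ℝ, t ∈ Icc a b → (φ.ξ a j).τ + (t - a) ≤ (φ.ξ a j).τmax := by
    filter_upwards [hφ.flow j] with t ht hm
    obtain ⟨-, h2, h3⟩ := hφ.timers_of_flow hm.1 fun u hu => hdom u ⟨hu.1, hu.2.trans hm.2⟩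
    rw [← h2, ← h3]
    exact (ht (hdom t hm)).1
  -- The flow constraint holds only for almost every time, so overshooting is refuted on a whole
  -- open interval of times rather than at `b`.
  obtain ⟨t, ⟨ht1, ht2⟩, ht⟩ := (Measure.dense_of_ae hae).inter_open_nonempty
    (Ioo (max a (a + ((φ.ξ a j).τmax - (φ.ξ a j).τ))) b) isOpen_Ioo
    (nonempty_Ioo.2 (max_lt hab (by linarith)))
  have h4 := ht ⟨(le_max_left _ _).trans ht1.le, ht2.le⟩
  have h5 := (le_max_right _ _).trans_lt ht1
  linarith

/-- A solution does not flow past a jump time. -/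
theorem IsSolution.le_of_jump (hφ : IsSolution (stcSystem f S Γ) w φ) {j : ℕ} {t u : ℝ}
    (ht : IsSamplingInstant φ j t) (hu : (u, j) ∈ φ.dom) : u ≤ t := by
  by_contra! hlt
  obtain ⟨s, -, hsj, -, hsd, hsm⟩ := φ.isHybridTimeDomain.exists_jumpTimes hu
  have hmono : s j ≤ t := (hsm j le_rfl t hlt.le ht.1).1
  have := hφ.tau_le_of_flow hlt fun v hv => hsd j le_rfl v ⟨hmono.trans hv.1, hv.2.trans hsj.ge⟩
  have hD : (φ.ξ t j).τ = (φ.ξ t j).τmax := (hφ.jump t j ht.1 ht.2).1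
  linarith

end Solutions

/-! ### The triggering algorithm -/

/-- The strict inequality for a selected candidate is kept because it makes that candidate positive,
which rules out the branch `C < V`. -/
theorem le_foldl_max_and_eq {ι : Type*} (c : ι → ℝ) (l : List ι) (h₀ : ℝ) :
    h₀ ≤ l.foldl (fun h i => if h < c i then c i else h) h₀ ∧
      (l.foldl (fun h i => if h < c i then c i else h) h₀ = h₀ ∨
        ∃ i, l.foldl (fun h i => if h < c i then c i else h) h₀ = c i ∧ h₀ < c i) := by
  induction l generalizing h₀ with
  | nil => simp
  | cons i l ih =>
    simp only [List.foldl_cons]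
    split_ifs with h
    · obtain ⟨h1, h2⟩ := ih (c i)
      refine ⟨h.le.trans h1, Or.inr ?_⟩
      rcases h2 with h2 | ⟨k, h2, h3⟩
      · exact ⟨i, h2, h⟩
      · exact ⟨k, h2, h.trans h3⟩
    · exact ih h₀

/-- Positivity forces `V ≤ C`. If `ε ≥ εref`, the decay comparison is monotonicity; otherwise it is
the exponential of the logarithmic bound in the minimum, or trivial when `V = 0`. -/
theorem candidate_spec {δ εref ε γ L V C : ℝ} (hV : 0 ≤ V)
    (hc : 0 < candidate δ εref ε γ L V C) :
    candidate δ εref ε γ L V C ≤ δ * Tmax γ (max (L + ε / 2) (1 - δ)) ∧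
      Real.exp (-ε * candidate δ εref ε γ L V C) * V ≤
        Real.exp (-εref * candidate δ εref ε γ L V C) * C := by
  by_cases hVC : V ≤ C
  swap
  · simp [candidate, hVC] at hc
  by_cases hr : 0 < -ε + εref
  swap
  · have h : candidate δ εref ε γ L V C = δ * Tmax γ (max (L + ε / 2) (1 - δ)) := by
      simp [candidate, hVC, hr]
    refine ⟨h.le, ?_⟩
    generalize candidate δ εref ε γ L V C = h at hc
    gcongr
    linarith
  by_cases hV0 : V = 0
  · have h : candidate δ εref ε γ L V C = δ * Tmax γ (max (L + ε / 2) (1 - δ)) := by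
      simp only [candidate, hVC, hr, if_true, if_pos hV0]
    refine ⟨h.le, ?_⟩
    rw [hV0, mul_zero]
    exact mul_nonneg (Real.exp_pos _).le (hV.trans hVC)
  have hVpos : 0 < V := lt_of_le_of_ne hV (Ne.symm hV0)
  have hCpos : 0 < C := hVpos.trans_le hVC
  have h : candidate δ εref ε γ L V C = min (δ * Tmax γ (max (L + ε / 2) (1 - δ)))
      ((Real.log C - Real.log V) / (-ε + εref)) := by
    simp only [candidate, hVC, hr, if_true, if_neg hV0]
  refine ⟨h.le.trans (min_le_left _ _), ?_⟩
  have h2 := h.le.trans (min_le_right _ _)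
  rw [le_div_iff₀ hr] at h2
  generalize candidate δ εref ε γ L V C = h at h2
  rw [← Real.exp_log hVpos, ← Real.exp_log hCpos, ← Real.exp_add, ← Real.exp_add,
    Real.exp_le_exp]
  linarith

/-- The growth rate `Λ_i` with which the maximum sampling interval of the parameter set `i` is
evaluated. -/
noncomputable def growthRate {n : ℕ} (δ : ℝ) (ε L : Fin (n + 1) → ℝ) : Fin (n + 1) → ℝ :=
  Fin.cases (L 0 + ε 0 / 2) fun i => max (L i.succ + ε i.succ / 2) (1 - δ)

theorem growthRate_pos {n : ℕ} {δ : ℝ} {ε L : Fin (n + 1) → ℝ} (hδ : δ < 1) (hL : 0 < L 0)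
    (hε : 0 < ε 0) (i : Fin (n + 1)) : 0 < growthRate δ ε L i := by
  refine Fin.cases ?_ (fun i => ?_) i
  · simp only [growthRate, Fin.cases_zero]
    positivity
  · simp only [growthRate, Fin.cases_succ]
    exact lt_max_of_lt_right (sub_pos.2 hδ)

theorem le_growthRate {n : ℕ} (δ : ℝ) (ε L : Fin (n + 1) → ℝ) (i : Fin (n + 1)) :
    L i + ε i / 2 ≤ growthRate δ ε L i := by
  refine Fin.cases ?_ (fun i => ?_) i
  · simp [growthRate]
  · simp [growthRate]

theorem fallback_eq {n : ℕ} (δ : ℝ) (ε γ L : Fin (n + 1) → ℝ) :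
    fallback δ (ε 0) (γ 0) (L 0) = δ * Tmax (γ 0) (growthRate δ ε L 0) := rfl

theorem fallback_le_refGamma {X : Type*} {n : ℕ} (δ εref : ℝ) (ε γ L : Fin (n + 1) → ℝ)
    (V : X → ℝ) (x : X) (η : ℝ) :
    fallback δ (ε 0) (γ 0) (L 0) ≤ refGamma δ εref ε γ L V x η :=
  (le_foldl_max_and_eq _ _ _).1

/-- One parameter set accounts for the chosen interval, and the flow estimate will be applied with
that set: index `0` in the fallback case, or one whose predicted decay stays below the reference. -/
theorem refGamma_spec {X : Type*} {n : ℕ} {δ εref : ℝ} {ε γ L : Fin (n + 1) → ℝ}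
    {V : X → ℝ} (h₀ : 0 < fallback δ (ε 0) (γ 0) (L 0)) {x : X} (hV : 0 ≤ V x) (η : ℝ) :
    ∃ i, refGamma δ εref ε γ L V x η ≤ δ * Tmax (γ i) (growthRate δ ε L i) ∧
      (i = 0 ∧ refGamma δ εref ε γ L V x η = fallback δ (ε 0) (γ 0) (L 0) ∨
        Real.exp (-ε i * refGamma δ εref ε γ L V x η) * V x ≤
          Real.exp (-εref * refGamma δ εref ε γ L V x η) * η) := by
  rcases (le_foldl_max_and_eq (fun i : Fin n => candidate δ εref (ε i.succ) (γ i.succ) (L i.succ)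
    (V x) η) (List.finRange n) (fallback δ (ε 0) (γ 0) (L 0))).2 with h | ⟨i, h, hlt⟩
  · have h : refGamma δ εref ε γ L V x η = fallback δ (ε 0) (γ 0) (L 0) := h
    exact ⟨0, by rw [h, fallback_eq], Or.inl ⟨rfl, h⟩⟩
  · have h : refGamma δ εref ε γ L V x η = candidate δ εref (ε i.succ) (γ i.succ) (L i.succ)
      (V x) η := h
    obtain ⟨h1, h2⟩ := candidate_spec hV (h₀.trans hlt)
    rw [h]
    exact ⟨i.succ, h1, Or.inr h2⟩

/-! ### Solutions after a jump -/

section Solutions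

variable {np nc nw : ℕ} {f : NCSVec np nc → NCSVec np nc → Vec nw → NCSVec np nc}
  {S : ℝ → NCSVec np nc → ℝ} {Γ : NCSVec np nc → ℝ → ℝ} {w : ℝ → Vec nw}
  {φ : HybridTrajectory (STCState np nc ℝ)}

theorem IsSolution.flow_components (hφ : IsSolution (stcSystem f S Γ) w φ) {j : ℕ} {a b : ℝ}
    (hab : a ≤ b) (hdom : ∀ u ∈ Icc a b, (u, j) ∈ φ.dom) :
    AbsolutelyContinuousOnInterval (fun t => (φ.ξ t j).x) a b ∧
      AbsolutelyContinuousOnInterval (fun t => (φ.ξ t j).e) a b ∧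
      ∀ᵐ t, t ∈ Icc a b →
        HasDerivAt (fun t => (φ.ξ t j).x) (f (φ.ξ t j).x (φ.ξ t j).e (w t)) t ∧
        HasDerivAt (fun t => (φ.ξ t j).e) (-f (φ.ξ t j).x (φ.ξ t j).e (w t)) t := by
  have hAC := φ.absolutelyContinuous j a b (hdom a (left_mem_Icc.2 hab)) (hdom b (right_mem_Icc.2 hab))
  refine ⟨hAC.lipschitzOnWith_comp (LipschitzWith.prod_fst.lipschitzOnWith (s := univ))
      fun _ _ => mem_univ _,
    hAC.lipschitzOnWith_comp
      ((LipschitzWith.prod_fst.comp LipschitzWith.prod_snd).lipschitzOnWith (s := univ))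
      fun _ _ => mem_univ _, ?_⟩
  filter_upwards [hφ.flow j] with t ht hm
  have h := (ht (hdom t hm)).2
  exact ⟨h.fst, h.snd.fst⟩

theorem IsSolution.after_jump (hφ : IsSolution (stcSystem f S Γ) w φ) {k : ℕ} {a b : ℝ}
    (hab : a ≤ b) (ha : (a, k) ∈ φ.dom) (hdom : ∀ u ∈ Icc a b, (u, k + 1) ∈ φ.dom)
    (hΓ : ∀ x η, 0 ≤ Γ x η) :
    (φ.ξ a (k + 1)).x = (φ.ξ a k).x ∧ (φ.ξ a (k + 1)).e = 0 ∧
      (φ.ξ b (k + 1)).η = S (φ.ξ a k).η (φ.ξ a k).x ∧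
      b - a ≤ Γ (φ.ξ a k).x (φ.ξ a k).η ∧
      ((b, k + 2) ∈ φ.dom → b - a = Γ (φ.ξ a k).x (φ.ξ a k).η) := by
  have hj := (hφ.jump a k ha (hdom a (left_mem_Icc.2 hab))).2
  have hx : (φ.ξ a (k + 1)).x = (φ.ξ a k).x := by rw [hj]; rfl
  have he : (φ.ξ a (k + 1)).e = 0 := by rw [hj]; rfl
  have hη : (φ.ξ a (k + 1)).η = S (φ.ξ a k).η (φ.ξ a k).x := by rw [hj]; rfl
  have hτ : (φ.ξ a (k + 1)).τ = 0 := by rw [hj]; rfl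
  have hm : (φ.ξ a (k + 1)).τmax = Γ (φ.ξ a k).x (φ.ξ a k).η := by rw [hj]; rfl
  obtain ⟨h1, h2, h3⟩ := hφ.timers_of_flow hab hdom
  refine ⟨hx, he, h1.trans hη, ?_, fun hb => ?_⟩
  -- An interval of length zero carries no information from the almost-everywhere flow constraint;
  -- there `Γ ≥ 0` is what gives the bound.
  · rcases hab.eq_or_lt with rfl | hlt
    · simpa using hΓ _ _
    · have := hφ.tau_le_of_flow hlt hdom
      rwa [hτ, zero_add, hm] at this
  · have : (φ.ξ b (k + 1)).τ = (φ.ξ b (k + 1)).τmax :=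
      (hφ.jump b (k + 1) (hdom b (right_mem_Icc.2 hab)) hb).1
    rw [h2, h3, hτ, hm] at this
    linarith

/-- Solutions starting with `τ = τ_max` jump at the initial time. -/
theorem IsSolution.first_jump (hφ : IsSolution (stcSystem f S Γ) w φ)
    (h0 : (φ.ξ 0 0).τmax = (φ.ξ 0 0).τ) {t : ℝ} (ht : 0 ≤ t)
    (hdom : ∀ u ∈ Icc 0 t, (u, 0) ∈ φ.dom) : t = 0 := by
  by_contra hne
  have := hφ.tau_le_of_flow (lt_of_le_of_ne ht (Ne.symm hne)) hdom
  rw [h0] at this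
  exact hne (le_antisymm (by linarith) ht)

theorem IsSolution.interevent_eq (hφ : IsSolution (stcSystem f S Γ) w φ) (hΓ : ∀ x η, 0 ≤ Γ x η)
    {j : ℕ} {t t' : ℝ} (ht : IsSamplingInstant φ j t) (ht' : IsSamplingInstant φ (j + 1) t') :
    t' - t = Γ (φ.ξ t j).x (φ.ξ t j).η := by
  obtain ⟨s, -, hsj, hs, hsd, -⟩ := φ.isHybridTimeDomain.exists_jumpTimes ht'.1
  have ha : IsSamplingInstant φ j (s (j + 1)) :=
    ⟨hsd j (by omega) _ ⟨hs j (by omega), le_rfl⟩, hsd (j + 1) le_rfl _ ⟨le_rfl, hs _ le_rfl⟩⟩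
  -- No flow passes a jump time, so the jump with a given counter happens at a unique time.
  have heq : t = s (j + 1) := le_antisymm (hφ.le_of_jump ha ht.1) (hφ.le_of_jump ht ha.1)
  have hle := hs (j + 1) le_rfl
  have hd := hsd (j + 1) le_rfl
  rw [show j + 1 + 1 = j + 2 from rfl, show s (j + 2) = t' from hsj] at hle hd
  rw [← heq] at hle hd
  exact (hφ.after_jump hle ht.1 hd hΓ).2.2.2.2 ht'.2

end Solutions

/-! ### Input-to-state stability -/

theorem HybridLyapunov.nonneg {np nc nw : ℕ}
    {f : NCSVec np nc → NCSVec np nc → Vec nw → NCSVec np nc} {V : NCSVec np nc → ℝ}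
    {αw : ℝ≥0 → ℝ≥0} {ε γ L : ℝ} (h : HybridLyapunov f V αw ε γ L) (x : NCSVec np nc) :
    0 ≤ V x := by
  obtain ⟨-, -, -, -, ⟨α, α', -, -, hV⟩, -⟩ := h
  exact (NNReal.coe_nonneg _).trans (hV x).1

theorem ae_le_supNorm {Win : Type*} [NormedAddCommGroup Win] {w : ℝ → Win} (hw : supNorm w ≠ ∞)
    {αw : ℝ≥0 → ℝ≥0} (hα : Monotone αw) :
    ∀ᵐ t : ℝ, 0 ≤ t → (αw ‖w t‖₊ : ℝ) ≤ αw (supNorm w).toNNReal := by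
  have h := enorm_ae_le_eLpNormEssSup w (volume.restrict (Ici (0 : ℝ)))
  rw [ae_restrict_iff' measurableSet_Ici] at h
  filter_upwards [h] with t ht h0
  have h1 : ‖w t‖ₑ ≤ supNorm w := by
    rw [supNorm, eLpNorm_exponent_top]
    exact ht h0
  have h2 : ‖w t‖₊ ≤ (supNorm w).toNNReal := by
    rw [← ENNReal.coe_le_coe, ENNReal.coe_toNNReal hw]
    exact h1
  exact NNReal.coe_le_coe.2 (hα h2)

theorem STCState.norm3_le {np nc : ℕ} (s : STCState np nc ℝ) :
    s.norm3 ≤ ‖s.x‖₊ + ‖s.e‖₊ + ‖s.η‖₊ := by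
  rw [STCState.norm3, NNReal.sqrt_le_iff_le_sq]
  have h : ∀ a b c : ℝ≥0, a ^ 2 + b ^ 2 + c ^ 2 ≤ (a + b + c) ^ 2 := fun a b c => by
    have : (a + b + c) ^ 2 = a ^ 2 + b ^ 2 + c ^ 2 + (2 * a * b + 2 * a * c + 2 * b * c) := by ring
    rw [this]
    exact le_self_add
  exact h _ _ _

theorem STCState.nnnorm_x_le_norm3 {np nc : ℕ} (s : STCState np nc ℝ) : ‖s.x‖₊ ≤ s.norm3 := by
  rw [STCState.norm3, NNReal.le_sqrt_iff_sq_le, add_assoc]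
  exact le_self_add

/-- One sampling interval preserves the bound of `V` at the sampling instants. -/
theorem storage_bound_step {a b c ε ε₀ εref tm h V V' η η₀ d D : ℝ} (hc : c ≤ ε₀)
    (hc' : c ≤ εref) (htm : 0 ≤ tm) (ha : 0 ≤ a) (hh : b - a = h) (h0 : 0 ≤ h) (hη₀ : 0 ≤ η₀)
    (hD0 : 0 ≤ D) (hD : Real.exp (-ε₀ * tm) * D + d ≤ D)
    (hη : η = Real.exp (-εref * a) * η₀) (hV : V ≤ Real.exp (-c * a) * η₀ + D)
    (hV' : V' ≤ Real.exp (-ε * (b - a)) * V + d)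
    (hmech : (ε = ε₀ ∧ h = tm) ∨ Real.exp (-ε * h) * V ≤ Real.exp (-εref * h) * η) :
    V' ≤ Real.exp (-c * b) * η₀ + D := by
  have hb : b = a + h := by linarith
  rw [hh] at hV'
  rcases hmech with ⟨rfl, rfl⟩ | hm
  · have h1 : Real.exp (-ε * h) * V ≤ Real.exp (-ε * h) * (Real.exp (-c * a) * η₀ + D) := by
      gcongr
    have h2 : Real.exp (-ε * h) * Real.exp (-c * a) ≤ Real.exp (-c * b) := by
      rw [← Real.exp_add, Real.exp_le_exp, hb]
      nlinarith
    have h3 := mul_le_mul_of_nonneg_right h2 hη₀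
    linarith
  · have h2 : Real.exp (-εref * h) * Real.exp (-εref * a) ≤ Real.exp (-c * b) := by
      rw [← Real.exp_add, Real.exp_le_exp, hb]
      nlinarith
    have h3 := mul_le_mul_of_nonneg_right h2 hη₀
    -- In this case the old offset is forgotten, and a single disturbance term already fits below
    -- the fixed point `D`.
    have h4 : d ≤ D := by
      have := mul_nonneg (Real.exp_pos (-ε₀ * tm)).le hD0
      linarith
    rw [hη, ← mul_assoc] at hm
    linarith

section Mechanism

variable {np nc nw n : ℕ} {f : NCSVec np nc → NCSVec np nc → Vec nw → NCSVec np nc}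
  {V : NCSVec np nc → ℝ} {αw : ℝ≥0 → ℝ≥0} {ε γ L : Fin (n + 1) → ℝ} {δ εref : ℝ}

theorem fallback_pos (hL : ∀ i, HybridLyapunov f V αw (ε i) (γ i) (L i)) (hε : 0 < ε 0)
    (hδ : δ ∈ Ioo (0 : ℝ) 1) : 0 < fallback δ (ε 0) (γ 0) (L 0) :=
  mul_pos hδ.1 (Tmax_pos (hL 0).2.1 (growthRate_pos hδ.2 (hL 0).1 hε 0))

set_option maxHeartbeats 1000000 in
/-- Along the solutions of the reference-function mechanism, `V`, the error and the reference
variable are bounded by an exponentially decaying function of the initial value plus a multiple of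
the bound of the disturbance. -/
theorem exists_decay_bound
    (hf : Continuous (fun p : NCSVec np nc × NCSVec np nc × Vec nw => f p.1 p.2.1 p.2.2))
    (hL : ∀ i, HybridLyapunov f V αw (ε i) (γ i) (L i)) (hε : 0 < ε 0) (hδ : δ ∈ Ioo (0 : ℝ) 1)
    (hεref : 0 < εref) :
    ∃ (σ : ℝ≥0 → ℝ≥0) (K κ a b : ℝ≥0), IsClassKInf σ ∧ 0 < K ∧ 0 < κ ∧ 0 < a ∧ 0 < b ∧
      (∀ r, r ≤ σ r) ∧
      ∀ (w : ℝ → Vec nw) (φ : HybridTrajectory (STCState np nc ℝ)),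
        IsSolution (stcSystem f (refUpdate εref (refGamma δ εref ε γ L V))
          (refGamma δ εref ε γ L V)) w φ →
        IsInitial (fun x η => η = V x) (φ.ξ 0 0) → supNorm w ≠ ∞ →
        ∀ (T : ℝ) (k : ℕ), (T, k + 1) ∈ φ.dom →
          ∃ Z : ℝ, 0 ≤ Z ∧ Z ≤ K * Real.exp (-(a * T + b * (k + 1 : ℕ))) * V (φ.ξ 0 0).x +
              κ * αw (supNorm w).toNNReal ∧
            V (φ.ξ T (k + 1)).x ≤ Z ∧ ‖(φ.ξ T (k + 1)).e‖₊ ≤ σ Z.toNNReal ∧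
            ‖(φ.ξ T (k + 1)).η‖ ≤ Z := by
  have hVnn : ∀ x, 0 ≤ V x := (hL 0).nonneg
  set tm := fallback δ (ε 0) (γ 0) (L 0) with htm
  have htm0 : 0 < tm := fallback_pos hL hε hδ
  have hΛ : ∀ i, 0 < growthRate δ ε L i := growthRate_pos hδ.2 (hL 0).1 hε
  choose σ hσ hflow using fun i =>
    (hL i).exists_flow_bound hf (hΛ i) (le_growthRate δ ε L i) hδ
  obtain ⟨hM, hhM⟩ : ∃ hM : ℝ, ∀ i, δ * Tmax (γ i) (growthRate δ ε L i) ≤ hM := by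
    obtain ⟨M, hM⟩ := (finite_range fun i => δ * Tmax (γ i) (growthRate δ ε L i)).bddAbove
    exact ⟨M, fun i => hM (mem_range_self i)⟩
  have hhM0 : 0 < hM := htm0.trans_le (hhM 0)
  obtain ⟨E, hE⟩ : ∃ E : ℝ, ∀ i, |ε i| ≤ E := by
    obtain ⟨M, hM⟩ := (finite_range fun i => |ε i|).bddAbove
    exact ⟨M, fun i => hM (mem_range_self i)⟩
  have hE0 : 0 ≤ E := (abs_nonneg _).trans (hE 0)
  -- The slower of the fallback rate and the reference rate; the other `ε i` may be negative and do
  -- not enter.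
  set c := min (ε 0) εref with hcdef
  have hc0 : 0 < c := lt_min hε hεref
  set ρ := Real.exp (-ε 0 * tm) with hρ
  have hρ1 : 0 < 1 - ρ := by
    rw [sub_pos, hρ, Real.exp_lt_one_iff]
    nlinarith
  set M := Real.exp (E * hM) with hMdef
  have hM1 : 1 ≤ M := Real.one_le_exp (by positivity)
  set N := hM * M with hN
  have hN0 : 0 < N := by positivity
  set κ := M * (N / (1 - ρ)) + N with hκ
  have hκ0 : 0 < κ := by positivity
  -- `M` bounds the growth in the last interval, `exp(c hM)` moves the decay from its start to `T`,
  -- and the third factor pays for counting `k + 1` jumps when only `k * tm ≤ T` is known.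
  set K := M * Real.exp (c * hM) * Real.exp (c * tm / 2 * 2) with hK
  have hK0 : 0 < K := by positivity
  refine ⟨fun r => r + ∑ i, σ i r, K.toNNReal, κ.toNNReal, (c / 2).toNNReal,
    (c * tm / 2).toNNReal, isClassKInf_add_sum _ fun i _ => hσ i, Real.toNNReal_pos.2 hK0,
    Real.toNNReal_pos.2 hκ0, Real.toNNReal_pos.2 (by positivity),
    Real.toNNReal_pos.2 (by positivity), fun r => le_self_add, ?_⟩
  intro w φ hφ hinit hw T k hT
  obtain ⟨-, hττ, hη0⟩ := hinit
  set η₀ := V (φ.ξ 0 0).x with hη₀def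
  have hη₀ : 0 ≤ η₀ := hVnn _
  set A : ℝ := (αw (supNorm w).toNNReal : ℝ) with hA
  have hA0 : 0 ≤ A := NNReal.coe_nonneg _
  have hwA := ae_le_supNorm hw (hL 0).2.2.1.1.2.1.monotone
  -- Fixed point of `D ↦ ρ * D + A * N`: contraction by `ρ` over a fallback interval plus the
  -- largest disturbance contribution `A * N` of one interval.
  set D := A * (N / (1 - ρ)) with hD
  have hD0 : 0 ≤ D := by positivity
  have hDfix : ρ * D + A * N ≤ D := by
    have : D * (1 - ρ) = A * N := by rw [hD]; field_simp
    linarith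
  obtain ⟨s, hs0, hsT, hs, hsd, -⟩ := φ.isHybridTimeDomain.exists_jumpTimes hT
  have hs1 : s 1 = 0 := by
    refine hφ.first_jump hττ ?_ fun u hu => hsd 0 (by omega) u (by rwa [hs0])
    rw [← hs0]
    exact hs 0 (by omega)
  have hΓ : ∀ x η, 0 ≤ refGamma δ εref ε γ L V x η := fun x η =>
    htm0.le.trans (fallback_le_refGamma ..)
  -- one sampling interval
  have hstep : ∀ l ≤ k, 0 ≤ s (l + 1) → ∃ i,
      s (l + 2) - s (l + 1) ≤ hM ∧
      (φ.ξ (s (l + 2)) (l + 1)).η = refUpdate εref (refGamma δ εref ε γ L V)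
        (φ.ξ (s (l + 1)) l).η (φ.ξ (s (l + 1)) l).x ∧
      V (φ.ξ (s (l + 2)) (l + 1)).x ≤ Real.exp (-ε i * (s (l + 2) - s (l + 1))) *
        V (φ.ξ (s (l + 1)) l).x + A * N ∧
      ‖(φ.ξ (s (l + 2)) (l + 1)).e‖₊ ≤ σ i (Real.exp (-ε i * (s (l + 2) - s (l + 1))) *
        V (φ.ξ (s (l + 1)) l).x + A * N).toNNReal ∧
      (i = 0 ∧ refGamma δ εref ε γ L V (φ.ξ (s (l + 1)) l).x (φ.ξ (s (l + 1)) l).η = tm ∨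
        Real.exp (-ε i * refGamma δ εref ε γ L V (φ.ξ (s (l + 1)) l).x (φ.ξ (s (l + 1)) l).η) *
          V (φ.ξ (s (l + 1)) l).x ≤
        Real.exp (-εref * refGamma δ εref ε γ L V (φ.ξ (s (l + 1)) l).x
          (φ.ξ (s (l + 1)) l).η) * (φ.ξ (s (l + 1)) l).η) ∧
      s (l + 2) - s (l + 1) ≤
        refGamma δ εref ε γ L V (φ.ξ (s (l + 1)) l).x (φ.ξ (s (l + 1)) l).η ∧
      (l < k → s (l + 2) - s (l + 1) =
        refGamma δ εref ε γ L V (φ.ξ (s (l + 1)) l).x (φ.ξ (s (l + 1)) l).η) := by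
    intro l hl hsl
    have hle := hs (l + 1) (by omega)
    have hd := hsd (l + 1) (by omega)
    have hdl : (s (l + 1), l) ∈ φ.dom := hsd l (by omega) _ ⟨hs l (by omega), le_rfl⟩
    obtain ⟨hx, he, hη, hlen, hlen'⟩ := hφ.after_jump hle hdl hd hΓ
    obtain ⟨i, hi1, hi2⟩ := refGamma_spec (εref := εref) htm0 (hVnn (φ.ξ (s (l + 1)) l).x)
      (φ.ξ (s (l + 1)) l).η
    obtain ⟨hAx, hAe, hae⟩ := hφ.flow_components hle hd
    obtain ⟨b1, b2⟩ := hflow i _ _ w _ _ A hle (hlen.trans hi1) hA0 hAx hAe he (by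
      filter_upwards [hwA, hae] with t h1 h2 ht
      exact ⟨h1 (hsl.trans ht.1), h2 ht⟩)
    rw [hx] at b1 b2
    have hlM : s (l + 2) - s (l + 1) ≤ hM := hlen.trans (hi1.trans (hhM i))
    have hl0 : 0 ≤ s (l + 2) - s (l + 1) := sub_nonneg.2 hle
    have hAN : A * (s (l + 2) - s (l + 1)) * Real.exp (|ε i| * (s (l + 2) - s (l + 1))) ≤
        A * N := by
      rw [hN, hMdef, mul_assoc]
      gcongr
      exact hE i
    refine ⟨i, hlM, hη, b1.trans (by gcongr), b2.trans ((hσ i).1.2.1.monotone ?_), hi2, hlen,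
      fun hlk => hlen' ?_⟩
    · exact Real.toNNReal_le_toNNReal (by gcongr)
    · exact hsd (l + 2) (by omega) _ ⟨le_rfl, hs _ (by omega)⟩
  -- the bounds at the sampling instants
  have hind : ∀ l ≤ k, (l : ℝ) * tm ≤ s (l + 1) ∧
      (φ.ξ (s (l + 1)) l).η = Real.exp (-εref * s (l + 1)) * η₀ ∧
      V (φ.ξ (s (l + 1)) l).x ≤ Real.exp (-c * s (l + 1)) * η₀ + D := by
    intro l
    induction l with
    | zero =>
      intro _
      rw [zero_add, hs1]
      refine ⟨by simp, by simpa using hη0, ?_⟩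
      simpa [← hη₀def] using hD0
    | succ l ih =>
      intro hl
      obtain ⟨i1, i2, i3⟩ := ih (by omega)
      have hsl : 0 ≤ s (l + 1) := le_trans (by positivity) i1
      obtain ⟨i, -, s1, s2, -, s3, -, s4⟩ := hstep l (by omega) hsl
      have s4 := s4 (by omega)
      refine ⟨?_, ?_, ?_⟩
      · have : tm ≤ s (l + 2) - s (l + 1) := by
          rw [s4]
          exact fallback_le_refGamma ..
        push_cast
        rw [show l + 1 + 1 = l + 2 from rfl]
        linarith
      · rw [show l + 1 + 1 = l + 2 from rfl, s1, refUpdate, ← s4, i2, ← mul_assoc, ← Real.exp_add]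
        congr 2
        ring
      · refine storage_bound_step (min_le_left _ _) (min_le_right _ _) htm0.le hsl s4 (hΓ _ _) hη₀
          hD0 hDfix i2 i3 s2 ?_
        exact s3.imp_left fun h => ⟨by rw [h.1], h.2⟩
  obtain ⟨i1, i2, i3⟩ := hind k le_rfl
  have hsk : 0 ≤ s (k + 1) := le_trans (by positivity) i1
  obtain ⟨i, s0, s1, s2, s3, -, s5, -⟩ := hstep k le_rfl hsk
  have hsT : s (k + 2) = T := hsT
  rw [hsT] at s0 s1 s2 s3 s5
  have hle : s (k + 1) ≤ T := hsT ▸ hs (k + 1) le_rfl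
  -- `T` may lie inside an unfinished interval, whereas the mechanism controls `V` only at the full
  -- length; a crude growth factor replaces it here.
  have hexp : Real.exp (-ε i * (T - s (k + 1))) ≤ M := by
    rw [hMdef, Real.exp_le_exp]
    have h1 : -ε i ≤ E := (neg_le_abs _).trans (hE i)
    have h2 : 0 ≤ T - s (k + 1) := sub_nonneg.2 hle
    nlinarith
  set P := Real.exp (-(c / 2 * T + c * tm / 2 * (k + 1 : ℕ))) with hP
  -- Half of the exponent stays with `T`; the other half becomes decay in the jump count through `k
  -- * tm ≤ T`.
  have hcT : Real.exp (-c * T) ≤ Real.exp (c * tm / 2 * 2) * P := by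
    rw [hP, ← Real.exp_add, Real.exp_le_exp]
    push_cast
    linarith [mul_pos hc0 htm0, mul_le_mul_of_nonneg_left (i1.trans hle) (half_pos hc0).le]
  have hcs : Real.exp (-c * s (k + 1)) ≤ Real.exp (c * hM) * Real.exp (-c * T) := by
    rw [← Real.exp_add, Real.exp_le_exp]
    linarith [mul_le_mul_of_nonneg_left s0 hc0.le]
  have hZle : Real.exp (-ε i * (T - s (k + 1))) * V (φ.ξ (s (k + 1)) k).x + A * N ≤
      K * P * η₀ + κ * A := by
    calc _ ≤ M * (Real.exp (-c * s (k + 1)) * η₀ + D) + A * N := by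
          have := hVnn (φ.ξ (s (k + 1)) k).x
          gcongr
      _ ≤ M * (Real.exp (c * hM) * (Real.exp (c * tm / 2 * 2) * P) * η₀ + D) + A * N := by
          have : Real.exp (-c * s (k + 1)) ≤ Real.exp (c * hM) * (Real.exp (c * tm / 2 * 2) * P) :=
            hcs.trans (by gcongr)
          gcongr
      _ = K * P * η₀ + κ * A := by
          rw [hK, hκ, hD]
          ring
  have hP0 : 0 < P := Real.exp_pos _
  refine ⟨K * P * η₀ + κ * A, by positivity, le_of_eq ?_, s2.trans hZle, ?_, ?_⟩
  · rw [Real.coe_toNNReal _ hK0.le, Real.coe_toNNReal _ hκ0.le, Real.coe_toNNReal _ (by positivity),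
      Real.coe_toNNReal _ (by positivity)]
  · calc ‖(φ.ξ T (k + 1)).e‖₊ ≤ σ i (K * P * η₀ + κ * A).toNNReal :=
          s3.trans ((hσ i).1.2.1.monotone (Real.toNNReal_le_toNNReal hZle))
      _ ≤ ∑ i, σ i (K * P * η₀ + κ * A).toNNReal :=
          Finset.single_le_sum (f := fun i => σ i (K * P * η₀ + κ * A).toNNReal)
            (fun _ _ => zero_le) (Finset.mem_univ i)
      _ ≤ _ := le_add_self
  -- At the jump `η` is already discounted over the whole coming interval, so it runs ahead of the
  -- clock and lies below `exp(-εref T) η₀`.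
  · rw [s1, refUpdate, i2, ← mul_assoc, ← Real.exp_add, Real.norm_of_nonneg (by positivity)]
    have h1 : Real.exp (-εref * refGamma δ εref ε γ L V (φ.ξ (s (k + 1)) k).x
        (Real.exp (-εref * s (k + 1)) * η₀) + -εref * s (k + 1)) ≤ Real.exp (-c * T) := by
      rw [Real.exp_le_exp]
      rw [i2] at s5
      have h2 : c ≤ εref := min_le_right _ _
      have h3 : 0 ≤ T := hsk.trans hle
      nlinarith
    have h2 : Real.exp (c * tm / 2 * 2) * P ≤ K * P := by
      rw [hK]
      have : 1 ≤ M * Real.exp (c * hM) :=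
        one_le_mul_of_one_le_of_one_le hM1 (Real.one_le_exp (by positivity))
      have h3 : 0 < Real.exp (c * tm / 2 * 2) * P := by positivity
      nlinarith
    have h3 := mul_le_mul_of_nonneg_right ((h1.trans hcT).trans h2) hη₀
    have h4 : 0 ≤ κ * A := by positivity
    linarith

theorem isISS_refSystem
    (hf : Continuous (fun p : NCSVec np nc × NCSVec np nc × Vec nw => f p.1 p.2.1 p.2.2))
    (hL : ∀ i, HybridLyapunov f V αw (ε i) (γ i) (L i)) (hε : 0 < ε 0) (hδ : δ ∈ Ioo (0 : ℝ) 1)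
    (hεref : 0 < εref) :
    IsISS (stcSystem f (refUpdate εref (refGamma δ εref ε γ L V)) (refGamma δ εref ε γ L V))
      (fun x η => η = V x) := by
  obtain ⟨σ, K, κ, a, b, hσ, hK, hκ, ha, hb, hid, hbound⟩ :=
    exists_decay_bound hf hL hε hδ hεref
  have hαw : IsClassKInf αw := (hL 0).2.2.1
  obtain ⟨-, -, -, -, ⟨αV, αV', hαV, hαV', hV⟩, -⟩ := hL 0
  obtain ⟨μ, hμ, hμi⟩ := hαV.exists_inverse
  have hVnn : ∀ x, 0 ≤ V x := (hL 0).nonneg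
  have hω : IsClassKInf (fun r => μ r + σ r + r) := (hμ.add hσ).add isClassKInf_id
  -- The summand `q` is for jump counter `0`, where the initial error is not controlled by `V`;
  -- together with the identity summand of the outer function it makes `β` at time zero at least
  -- `q`. The factor `2` comes from `IsClassKInf.map_add_le`.
  have hκ' : IsClassKInf (fun q => 2 * (K * αV' q + q)) :=
    (isClassKInf_mul two_pos).comp (((isClassKInf_mul hK).comp hαV').add isClassKInf_id)
  refine ⟨_, _, isClassKLL_exp hω hκ' ha hb,
    hω.comp ((isClassKInf_mul two_pos).comp ((isClassKInf_mul hκ).comp hαw)), ?_⟩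
  intro w φ hφ hinit hw t j hj
  set q := (φ.ξ 0 0).norm3 with hq
  rcases j with _ | k
  · obtain ⟨s, hs0, hsT, hs, hsd, -⟩ := φ.isHybridTimeDomain.exists_jumpTimes hj
    have ht : t = 0 := by
      refine hφ.first_jump hinit.2.1 (φ.isHybridTimeDomain.1 _ hj) fun u hu => ?_
      exact hsd 0 le_rfl u (by rwa [hs0, hsT])
    subst ht
    refine le_trans ?_ le_self_add
    simp only [Real.toNNReal_zero, NNReal.coe_zero, mul_zero, Nat.cast_zero, add_zero, neg_zero,
      Real.exp_zero, Real.toNNReal_one, mul_one]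
    refine le_trans ?_ le_add_self
    rw [← hq, mul_add, two_mul q]
    exact le_add_self.trans le_add_self
  · obtain ⟨Z, hZ0, hZle, hVZ, heZ, hηZ⟩ := hbound w φ hφ hinit hw t k hj
    set X := φ.ξ t (k + 1) with hX
    have ht0 : 0 ≤ t := φ.isHybridTimeDomain.1 _ hj
    have h1 : X.norm3 ≤ μ Z.toNNReal + σ Z.toNNReal + Z.toNNReal := by
      refine (STCState.norm3_le X).trans (add_le_add (add_le_add (hμi _ _ ?_) heZ) ?_)
      · rw [← NNReal.coe_le_coe, Real.coe_toNNReal _ hZ0]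
        exact (hV _).1.trans hVZ
      · rw [← NNReal.coe_le_coe, Real.coe_toNNReal _ hZ0]
        exact hηZ
    set p : ℝ≥0 := (Real.exp (-(a * (t.toNNReal : ℝ≥0) + b * ((k + 1 : ℕ) : ℝ≥0)))).toNNReal
      with hp
    have h2 : Z.toNNReal ≤ (K * αV' q + q) * p + κ * αw (supNorm w).toNNReal := by
      rw [← NNReal.coe_le_coe, Real.coe_toNNReal _ hZ0]
      refine hZle.trans ?_
      push_cast
      rw [hp, Real.coe_toNNReal _ (Real.exp_pos _).le, Real.coe_toNNReal _ ht0]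
      have h3 : V (φ.ξ 0 0).x ≤ αV' q :=
        (hV _).2.trans (NNReal.coe_le_coe.2
          (hαV'.1.2.1.monotone (STCState.nnnorm_x_le_norm3 _)))
      push_cast
      have h4 := Real.exp_pos (-(a * t + b * ((k : ℝ) + 1)))
      have h5 := mul_le_mul_of_nonneg_left h3
        (mul_nonneg K.coe_nonneg h4.le)
      have h6 := mul_nonneg q.coe_nonneg h4.le
      nlinarith
    refine h1.trans ((hω.1.2.1.monotone h2).trans ((hω.map_add_le _ _).trans ?_))
    rw [← mul_assoc 2]

end Mechanism

end DynSTC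

open DynSTC
theorem theorem3 {np nc nu nw n : ℕ}
    (fp : Vec np → Vec nu → Vec nw → Vec np)
    (fc : Vec nc → Vec np → Vec nc) (gc : Vec nc → Vec np → Vec nu)
    (hf : Continuous (fun p : NCSVec np nc × NCSVec np nc × Vec nw =>
      closedLoop fp fc gc p.1 p.2.1 p.2.2))
    (V : NCSVec np nc → ℝ) (αw : NNReal → NNReal) (ε γ L : Fin (n + 1) → ℝ)
    (hLyap : ∀ i, HybridLyapunov (closedLoop fp fc gc) V αw (ε i) (γ i) (L i))
    (hε : 0 < ε 0) (δ εref : ℝ) (hδ : δ ∈ Set.Ioo (0 : ℝ) 1) (hεref : 0 < εref)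
    (H : HybridSystem (STCState np nc ℝ) (Vec nw))
    (hH : H = stcSystem (closedLoop fp fc gc)
      (refUpdate εref (refGamma δ εref ε γ L V)) (refGamma δ εref ε γ L V)) :
    0 < fallback δ (ε 0) (γ 0) (L 0) ∧
    (∀ (w : ℝ → Vec nw) (φ : HybridTrajectory (STCState np nc ℝ)), IsSolution H w φ →
      IsInitial (fun x η => η = V x) (φ.ξ 0 0) →
      ∀ (j : ℕ) (t t' : ℝ), IsSamplingInstant φ j t → IsSamplingInstant φ (j + 1) t' →
        fallback δ (ε 0) (γ 0) (L 0) ≤ t' - t) ∧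
    IsISS H (fun x η => η = V x) := by
  subst hH
  have hpos := fallback_pos hLyap hε hδ
  refine ⟨hpos, fun w φ hφ _ j t t' ht ht' => ?_, isISS_refSystem hf hLyap hε hδ hεref⟩
  rw [hφ.interevent_eq (fun x η => hpos.le.trans (fallback_le_refGamma ..)) ht ht']
  exact fallback_le_refGamma ..
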